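/- Let $\dot W$ be a Gaussian white noise on $L_2((0,\pi))$ over a probability space: a collection of Gaussian random variables $\dot W(h)$, $h\in L_2((0,\pi))$, with $\mathbb E\,\dot W(h)=0$ and $\mathbb E\big(\dot W(g)\dot W(h)\big)=\int_0^\pi g(x)h(x)\,dx$. Let $\mathfrak m_0(x)=1/\sqrt{\pi}$, $\mathfrak m_k(x)=\sqrt{2/\pi}\cos(kx)$, $k\ge 1$, be the Fourier cosine basis of $L_2((0,\pi))$ and $\xi_k=\dot W(\mathfrak m_k)$. Let $\mathcal J$ be the set of multi-indices $\alpha=(\alpha_k)_{k\ge 0}$ of non-negative integers with $|\alpha|=\sum_k\alpha_k<\infty$, let $\epsilon(k)$ be the $k$-th unit multi-index, and let $\xi_\alpha=\prod_k \mathrm{He}_{\alpha_k}(\xi_k)/\sqrt{\alpha_k!}$, where $\mathrm{He}_n(x)=(-1)^n e^{x^2/2}\frac{d^n}{dx^n}e^{-x^2/2}$. For $q>1$, $L_{2,q}(W;\mathbb R)$ is the set of square-integrable random variables $\eta$, measurable with respect to the $\sigma$-algebra generated by $\dot W(h)$, $h\in L_2((0,\pi))$, such that $\sum_{\alpha\in\mathcal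 J}q^{|\alpha|}\,\big|\mathbb E(\eta\,\xi_\alpha)\big|^2<\infty$. Consider the equation with Wick product $$u_t=u_{xx}+u\diamond\dot W(x),\quad t>0,\ 0<x<\pi,\qquad u_x(t,0)=u_x(t,\pi)=0,\quad u(0,x)=u_0(x).$$ Its chaos solution is the collection of functions $u_\alpha=u_\alpha(t,x)$, $\alpha\in\mathcal J$, continuous in $x\in[0,\pi]$ for each $t>0$ and integrable over $(0,T)\times(0,\pi)$ for each $T>0$, satisfying the propagator $$\partial_t u_\alpha=\partial_{xx}u_\alpha+\sum_k\sqrt{\alpha_k}\,\mathfrak m_k\,u_{\alpha-\epsilon(k)},\qquad u_{(0)}(0,\cdot)=u_0,\quad u_\alpha(0,\cdot)=0\ \text{ for } |\alpha|>0,$$ with zero Neumann boundary conditions, in the weak sense: for every smooth $\varphi$ on $[0,\pi]$ with $\varphi'(0)=\varphi'(\pi)=0$ and every $t>0$, $$\int_0^\pi u_\alpha(t,x)\varphi(x)\,dx=\mathbf 1_{\{\alpha=0\}}\int_0^\pi u_0\varphi\,dx+\int_0^t\!\!\int_0^\pi u_\alpha(s,x)\varphi''(x)\,dx\,ds+\int_0^t\!\!\int_0^\pi\sum_k\sqrt{\alpha_k}\,\mathfrak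 m_k(x)u_{\alpha-\epsilon(k)}(s,x)\varphi(x)\,dx\,ds.$$ **Theorem.** Assume that $u_0\in L_p((0,\pi))$ for some $1\le p\le\infty$ (non-random). Then the equation has a unique chaos solution, and for every $t>0$ and $x\in(0,\pi)$ each $u_\alpha(t,\cdot)$ is differentiable at $x$ and $$u_x(t,x)=\sum_{\alpha\in\mathcal J}\frac{\partial u_\alpha(t,x)}{\partial x}\,\xi_\alpha\ \in\ \bigcap_{q>1}L_{2,q}(W;\mathbb R);$$ that is, the series converges in mean square to a single random variable with chaos coefficients $\mathbb E\big(u_x(t,x)\,\xi_\alpha\big)=\partial u_\alpha(t,x)/\partial x$, which belongs to $L_{2,q}(W;\mathbb R)$ for every $q>1$. -/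

import Mathlib

open MeasureTheory ProbabilityTheory Filter Topology Set
open scoped ENNReal

noncomputable section

/-- Lebesgue measure on the interval `(0, π)`. -/
def intervalMeasure : Measure ℝ := volume.restrict (Ioo 0 Real.pi)

instance : IsFiniteMeasure intervalMeasure := by
  unfold intervalMeasure
  infer_instance

/-- The real Hilbert space `L₂((0, π))`. -/
abbrev L2Interval : Type := Lp ℝ 2 intervalMeasure

/-- The Fourier cosine basis of `L₂((0, π))`, indexed from `0`:
`1 / √π` for `k = 0` and `√(2/π) cos (k x)` for `k ≥ 1`. -/
def cosBasis (k : ℕ) (x : ℝ) : ℝ :=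
  if k = 0 then 1 / √Real.pi else √(2 / Real.pi) * Real.cos (k * x)

theorem continuous_cosBasis (k : ℕ) : Continuous (cosBasis k) := by
  unfold cosBasis
  split_ifs <;> fun_prop

theorem abs_cosBasis_le (k : ℕ) (x : ℝ) :
    ‖cosBasis k x‖ ≤ 1 / √Real.pi + √(2 / Real.pi) := by
  have h1 : 0 ≤ 1 / √Real.pi := by positivity
  have h2 : 0 ≤ √(2 / Real.pi) := by positivity
  unfold cosBasis
  split_ifs
  · rw [Real.norm_eq_abs, abs_of_nonneg h1]
    linarith
  · rw [norm_mul, Real.norm_eq_abs, Real.norm_eq_abs, abs_of_nonneg h2]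
    have := mul_le_mul_of_nonneg_left (Real.abs_cos_le_one (k * x)) h2
    linarith

theorem memLp_cosBasis (k : ℕ) : MemLp (cosBasis k) 2 intervalMeasure :=
  MemLp.of_bound (continuous_cosBasis k).aestronglyMeasurable _
    (Eventually.of_forall (abs_cosBasis_le k))

/-- The `k`-th element of the cosine basis as an element of `L₂((0, π))`. -/
def cosBasisL2 (k : ℕ) : L2Interval := (memLp_cosBasis k).toLp (cosBasis k)

/-- The collection `𝒥` of multi-indices `α = (α_k)` with `|α| = ∑ α_k < ∞`. -/
abbrev MultiIdx : Type := ℕ →₀ ℕ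

section Noise

variable {Ω : Type*} [MeasurableSpace Ω]

/-- A Gaussian white noise on `L₂((0, π))`: a collection of Gaussian random variables `W h`,
`h ∈ L₂((0, π))`, with `E W(h) = 0` and `E (W(g) W(h)) = (g, h)`. -/
structure IsWhiteNoise (P : Measure Ω) (W : L2Interval → Ω → ℝ) : Prop where
  measurable : ∀ h, Measurable (W h)
  gaussian : ∀ h, HasGaussianLaw (W h) P
  mean_zero : ∀ h, ∫ ω, W h ω ∂P = 0
  covariance : ∀ g h, ∫ ω, W g ω * W h ω ∂P = inner ℝ g h

/-- The sigma-algebra generated by the random variables `W h`, `h ∈ L₂((0, π))`. -/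
abbrev noiseSigma {Ω : Type*} (W : L2Interval → Ω → ℝ) : MeasurableSpace Ω :=
  ⨆ h, MeasurableSpace.comap (W h) (borel ℝ)

/-- The element `ξ_α = ∏_k He_{α_k}(ξ_k) / √(α_k!)`, `ξ_k = W(m_k)`, of the Cameron–Martin basis,
with `He_n` the (probabilists') Hermite polynomials. -/
def chaosBasis {Ω : Type*} (W : L2Interval → Ω → ℝ) (α : MultiIdx) (ω : Ω) : ℝ :=
  ∏ k ∈ α.support,
    Polynomial.aeval (W (cosBasisL2 k) ω) (Polynomial.hermite (α k)) / √((α k).factorial : ℝ)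

/-- The chaos coefficient `η_α = E (η ξ_α)`. -/
def chaosCoeff (P : Measure Ω) (W : L2Interval → Ω → ℝ) (η : Ω → ℝ) (α : MultiIdx) : ℝ :=
  ∫ ω, η ω * chaosBasis W α ω ∂P

/-- `η ∈ L_{2,q}(W; ℝ)` for `q > 1`: `η` is measurable with respect to the sigma-algebra generated
by the noise, square-integrable, and `∑_α q^{|α|} η_α² < ∞`. -/
structure MemL2q (P : Measure Ω) (W : L2Interval → Ω → ℝ) (q : ℝ) (η : Ω → ℝ) : Prop where
  measurable : Measurable[noiseSigma W] η
  memLp : MemLp η 2 P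
  summable : Summable fun α : MultiIdx => q ^ α.degree * chaosCoeff P W η α ^ 2

/-- `η = ∑_α c_α ξ_α`, with (unconditional) convergence in mean square. -/
def IsChaosSum (P : Measure Ω) (W : L2Interval → Ω → ℝ) (c : MultiIdx → ℝ) (η : Ω → ℝ) : Prop :=
  Tendsto (fun s : Finset MultiIdx =>
    eLpNorm (fun ω => η ω - ∑ α ∈ s, c α * chaosBasis W α ω) 2 P) atTop (𝓝 0)

end Noise

/-- Smooth test functions on `[0, π]` with zero Neumann boundary values. -/
structure IsNeumannTest (φ : ℝ → ℝ) : Prop where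
  smooth : ContDiff ℝ ((⊤ : ℕ∞) : WithTop ℕ∞) φ
  deriv_zero : deriv φ 0 = 0
  deriv_pi : deriv φ Real.pi = 0

/-- The chaos solution of `u_t = u_xx + u ⋄ Ẇ(x)` on `(0, π)` with zero Neumann boundary conditions
and `u(0, ·) = u₀`: a collection of functions `u_α(t, x)`, `t > 0`, continuous in `x ∈ [0, π]`,
satisfying the propagator
`∂_t u_α = ∂_xx u_α + ∑_k √α_k m_k u_{α - ε(k)}`, `u_α(0, ·) = u₀` if `α = 0` and `0` otherwise,
in the weak sense: integrated in time, and in space against smooth test functions with zero Neumann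
boundary values (which carries the Neumann boundary condition for `u_α`). -/
structure IsChaosSolution (u₀ : ℝ → ℝ) (u : MultiIdx → ℝ → ℝ → ℝ) : Prop where
  continuousOn : ∀ α, ∀ t > 0, ContinuousOn (u α t) (Icc 0 Real.pi)
  integrable : ∀ α, ∀ T > 0,
    IntegrableOn (fun z : ℝ × ℝ => u α z.1 z.2) (Ioo 0 T ×ˢ Ioo 0 Real.pi)
  propagator : ∀ (α : MultiIdx) (φ : ℝ → ℝ), IsNeumannTest φ → ∀ t > 0,
    ∫ x in Ioo 0 Real.pi, u α t x * φ x =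
      (if α = 0 then ∫ x in Ioo 0 Real.pi, u₀ x * φ x else 0)
      + (∫ s in Ioo 0 t, ∫ x in Ioo 0 Real.pi, u α s x * deriv (deriv φ) x)
      + ∫ s in Ioo 0 t, ∫ x in Ioo 0 Real.pi,
          (∑ k ∈ α.support, √(α k : ℝ) * cosBasis k x * u (α - Finsupp.single k 1) s x) * φ x

end

/-! The propagator is lower triangular in the degree of `α`: degree zero is a heat equation, and
each later degree is a heat equation whose source involves only the previous one. Every `u_α` is
therefore an explicit cosine series with coefficients given by Duhamel's formula. The class `IsTame`
(spatial supremum of order `s ^ (-3/4)`) is stable under this recursion. The weak form is checked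
coefficient by coefficient. Uniqueness holds because the cosine coefficients of a difference of two
solutions satisfy `d = -k² ∫ d`, and a continuous function with no cosine coefficients vanishes.

The substance is a mean square bound on each degree. Testing the sources of degree `n + 1` against a
heat kernel `K`, Cauchy–Schwarz over the modes (with `∑ α_k = n + 1`) and Bessel's inequality bound
the sum of squares by `(n + 1) ∫ K² ∑ u_β²`, with `β` of degree `n`
(`sum_sq_integral_mul_chaosSource_le`). With Minkowski in time this becomes `A_{n+1}(t) ≤ √(n+1) ∫
‖K_{t-s}‖ A_n(s) ds`, where `‖K_r‖ ≤ C r ^ (-3/8)`.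

The iteration is controlled by a weight `exp (l t)`: each step gains `l ^ (-9/16)`, as `3/8 + 9/16 <
1`. Since `9/16 > 1/2`, the choice `l = n + 1` beats the factor `√n!` and leaves superexponential
decay, summable against every `q ^ n`. The space derivative changes only the last kernel, whose norm
`C r ^ (-7/8)` is still integrable.

On the probabilistic side, the covariance forces linearity of the noise, so the `ξ_k` are
independent standard Gaussians and the `ξ_α` are orthonormal. A square-summable family of
coefficients then sums in mean square. -/

/-! ### Gaussian integration by parts and orthogonality of Hermite polynomials -/

section GaussianPolynomials

open Polynomial

theorem integrable_eval_gaussianReal (p : ℝ[X]) :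
    Integrable (fun x => p.eval x) (gaussianReal 0 1) := by
  have hpow : ∀ n : ℕ, Integrable (fun x : ℝ => x ^ n) (gaussianReal 0 1) := fun n => by
    have h := (memLp_id_gaussianReal (μ := 0) (v := 1) n).integrable_norm_pow'
    refine h.mono' (by fun_prop) (Eventually.of_forall fun x => ?_)
    simp
  simp only [eval_eq_sum_range]
  exact integrable_finsetSum _ fun i _ => (hpow i).const_mul _

theorem memLp_eval_gaussianReal (p : ℝ[X]) :
    MemLp (fun x => p.eval x) 2 (gaussianReal 0 1) := by
  rw [memLp_two_iff_integrable_sq (by fun_prop)]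
  exact (integrable_eval_gaussianReal (p ^ 2)).congr (Eventually.of_forall fun x => eval_pow 2)

/-- The Gaussian density `ρ` satisfies `ρ' = -x ρ`, and the derivative of the integrable function `ρ
p` is integrable, so it integrates to zero over the line. -/
theorem integral_mul_eval_gaussianReal (p : ℝ[X]) :
    ∫ x, x * p.eval x ∂gaussianReal 0 1 = ∫ x, (derivative p).eval x ∂gaussianReal 0 1 := by
  have hint : ∀ q : ℝ[X], Integrable (fun x => gaussianPDFReal 0 1 x * q.eval x) := fun q => by
    have h := integrable_eval_gaussianReal q
    rw [gaussianReal_of_var_ne_zero _ one_ne_zero,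
      integrable_withDensity_iff_integrable_smul' (measurable_gaussianPDF _ _)
        (ae_of_all _ fun _ => gaussianPDF_lt_top)] at h
    simpa only [toReal_gaussianPDF, smul_eq_mul] using h
  have hd : ∀ x, HasDerivAt (gaussianPDFReal 0 1) (-x * gaussianPDFReal 0 1 x) x := fun x => by
    have h1 : HasDerivAt (fun x : ℝ => -(x - 0) ^ 2 / (2 * ((1 : NNReal) : ℝ))) (-x) x := by
      refine ((((hasDerivAt_id x).sub_const 0).pow 2).neg.div_const
        (2 * ((1 : NNReal) : ℝ))).congr_deriv ?_
      simp
      ring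
    have h2 := h1.exp.const_mul (√(2 * Real.pi * ((1 : NNReal) : ℝ)))⁻¹
    rw [gaussianPDFReal_def]
    refine h2.congr_deriv ?_
    ring
  have hz := integral_eq_zero_of_hasDerivAt_of_integrable
    (fun x => (hd x).mul (p.hasDerivAt x)) ?_ (hint p)
  · have e : ∀ x, -x * gaussianPDFReal 0 1 x * p.eval x
        + gaussianPDFReal 0 1 x * (derivative p).eval x
        = gaussianPDFReal 0 1 x * (derivative p).eval x
          - gaussianPDFReal 0 1 x * (X * p).eval x := fun x => by
      simp
      ring
    simp only [e] at hz
    rw [integral_sub (hint _) (hint _), sub_eq_zero] at hz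
    rw [integral_gaussianReal_eq_integral_smul one_ne_zero,
      integral_gaussianReal_eq_integral_smul one_ne_zero]
    simpa using hz.symm
  · refine ((hint (derivative p)).sub (hint (X * p))).congr (Eventually.of_forall fun x => ?_)
    simp
    ring

/-- By `He_{n+1} = x He_n - He_n'` and one integration by parts, each Hermite degree moves one
derivative onto `p`. -/
theorem integral_hermite_mul_eval_gaussianReal (n : ℕ) (p : ℝ[X]) :
    ∫ x, aeval x (hermite n) * p.eval x ∂gaussianReal 0 1
      = ∫ x, (derivative^[n] p).eval x ∂gaussianReal 0 1 := by
  induction n generalizing p with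
  | zero => simp
  | succ n ih =>
    set h : ℝ[X] := (hermite n).map (algebraMap ℤ ℝ) with hh
    have e : ∀ x, aeval x (hermite (n + 1)) * p.eval x
        = x * (h * p).eval x - (derivative h * p).eval x := fun x => by
      rw [hermite_succ, hh, derivative_map]
      simp only [map_sub, map_mul, aeval_X, eval_mul, eval_map_algebraMap]
      ring
    simp only [e]
    rw [integral_sub, integral_mul_eval_gaussianReal, ← integral_sub]
    · rw [Function.iterate_succ_apply, ← ih]
      congr 1
      ext x
      rw [derivative_mul, eval_add, eval_mul, eval_mul, hh, eval_map_algebraMap]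
      ring
    · exact integrable_eval_gaussianReal _
    · exact integrable_eval_gaussianReal _
    · exact (integrable_eval_gaussianReal (X * (h * p))).congr
        (Eventually.of_forall fun x => by simp only [eval_mul, eval_X])
    · exact integrable_eval_gaussianReal _

theorem integral_hermite_mul_hermite_gaussianReal (m n : ℕ) :
    ∫ x, aeval x (hermite m) * aeval x (hermite n) ∂gaussianReal 0 1
      = if m = n then (m.factorial : ℝ) else 0 := by
  -- The higher-degree factor is the one moved: `m` derivatives annihilate a polynomial of degree `n
  -- < m` and turn a monic one of degree `m` into `m!`.
  have key : ∀ m n : ℕ, n ≤ m → ∫ x, aeval x (hermite m) * aeval x (hermite n) ∂gaussianReal 0 1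
      = if m = n then (m.factorial : ℝ) else 0 := fun m n hnm => by
    have h := integral_hermite_mul_eval_gaussianReal m ((hermite n).map (algebraMap ℤ ℝ))
    simp only [eval_map_algebraMap] at h
    have hdeg : ((hermite n).map (algebraMap ℤ ℝ)).natDegree = n := by
      rw [(hermite_monic n).natDegree_map, natDegree_hermite]
    rw [h]
    split_ifs with hmn
    · subst hmn
      have hm := ((hermite_monic m).map (algebraMap ℤ ℝ))
      have : derivative^[m] ((hermite m).map (algebraMap ℤ ℝ)) = C (m.factorial : ℝ) := by
        have h0 : (derivative^[m] ((hermite m).map (algebraMap ℤ ℝ))).natDegree = 0 := by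
          have := natDegree_iterate_derivative ((hermite m).map (algebraMap ℤ ℝ)) m
          omega
        rw [eq_C_of_natDegree_eq_zero h0, coeff_iterate_derivative]
        have hc : ((hermite m).map (algebraMap ℤ ℝ)).coeff (0 + m) = 1 := by
          simp
        rw [hc]
        simp [Nat.descFactorial_self]
      simp only [this, eval_C]
      simp
    · rw [iterate_derivative_eq_zero (by omega)]
      simp
  rcases le_total n m with h | h
  · exact key m n h
  · simp only [mul_comm (aeval _ (hermite m)), key n m h, eq_comm (a := n)]
    split_ifs with hmn <;> simp [hmn]

end GaussianPolynomials

/-! ### Orthonormal series and joint Gaussianity of the noise -/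

/-- In an `L²` space, a square-summable series along an orthonormal family of functions converges. -/
theorem exists_tendsto_sum_of_orthonormal {X ι : Type*} [MeasurableSpace X] [DecidableEq ι]
    (μ : Measure X) (f : ι → X → ℝ) (hf : ∀ i, MemLp (f i) 2 μ)
    (horth : ∀ i j, ∫ x, f i x * f j x ∂μ = if i = j then 1 else 0)
    (c : ι → ℝ) (hc : Summable fun i => c i ^ 2) :
    ∃ v : X → ℝ, StronglyMeasurable v ∧ MemLp v 2 μ ∧
      Tendsto (fun s : Finset ι => eLpNorm (fun x => v x - ∑ i ∈ s, c i * f i x) 2 μ)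
        atTop (𝓝 0) := by
  set e : ι → Lp ℝ 2 μ := fun i => (hf i).toLp (f i) with he
  have hon : Orthonormal ℝ e := by
    rw [orthonormal_iff_ite]
    intro i j
    rw [L2.inner_def, ← horth i j]
    refine integral_congr_ae ?_
    filter_upwards [(hf i).coeFn_toLp, (hf j).coeFn_toLp] with x hi hj
    rw [he]
    simp only [hi, hj, RCLike.inner_apply, conj_trivial]
    ring
  have hsum : Summable fun i => c i • e i := by
    have := (hon.orthogonalFamily.summable_iff_norm_sq_summable c).2 (by simpa using hc)
    simpa using this
  obtain ⟨v, hv⟩ := hsum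
  refine ⟨v, Lp.stronglyMeasurable v, Lp.memLp v, ?_⟩
  have h := tendsto_iff_norm_sub_tendsto_zero.1 hv
  rw [← ENNReal.tendsto_toReal_iff (fun s => ?_) ENNReal.zero_ne_top]
  · refine h.congr fun s => ?_
    rw [norm_sub_rev, Lp.norm_def]
    congr 1
    refine eLpNorm_congr_ae ?_
    have hs : ∀ᵐ x ∂μ, ∀ i ∈ s, (c i • e i : Lp ℝ 2 μ) x = c i * f i x := by
      rw [Filter.eventually_all_finset]
      intro i _
      filter_upwards [Lp.coeFn_smul (c i) (e i), (hf i).coeFn_toLp] with x h1 h2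
      rw [h1, Pi.smul_apply, he, h2, smul_eq_mul]
    filter_upwards [Lp.coeFn_sub v (∑ i ∈ s, c i • e i), Lp.coeFn_finsetSum s (fun i => c i • e i), hs]
      with x h1 h2 h3
    rw [h1, Pi.sub_apply, h2, Finset.sum_apply, Finset.sum_congr rfl h3]
  · exact ((Lp.memLp v).sub (memLp_finsetSum s fun i _ => (hf i).const_mul (c i))).2.ne

namespace IsWhiteNoise

variable {Ω : Type*} [MeasurableSpace Ω] {P : Measure Ω} {W : L2Interval → Ω → ℝ}

theorem memLp_two (hW : IsWhiteNoise P W) (h : L2Interval) : MemLp (W h) 2 P :=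
  (hW.gaussian h).memLp_two

/-- Linearity of the noise is not assumed. The covariance makes the defect orthogonal to every `W
k`; the defect is itself a combination of such variables, so its second moment is zero. -/
theorem ae_eq_sum (hW : IsWhiteNoise P W) {ι : Type*} (s : Finset ι) (a : ι → ℝ)
    (h : ι → L2Interval) :
    W (∑ i ∈ s, a i • h i) =ᵐ[P] fun ω => ∑ i ∈ s, a i * W (h i) ω := by
  set g := ∑ i ∈ s, a i • h i with hg
  have hmem : MemLp (fun ω => W g ω - ∑ i ∈ s, a i * W (h i) ω) 2 P :=
    (hW.memLp_two g).sub (memLp_finsetSum s fun i _ => (hW.memLp_two (h i)).const_mul (a i))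
  have hint : ∀ k l, Integrable (fun ω => W k ω * W l ω) P := fun k l =>
    (hW.memLp_two k).integrable_mul (hW.memLp_two l)
  have hzero : ∀ k, ∫ ω, (W g ω - ∑ i ∈ s, a i * W (h i) ω) * W k ω ∂P = 0 := fun k => by
    simp only [sub_mul, Finset.sum_mul, mul_assoc]
    rw [integral_sub (hint g k) (integrable_finsetSum s fun i _ => (hint (h i) k).const_mul (a i)),
      integral_finsetSum s fun i _ => (hint (h i) k).const_mul (a i)]
    simp only [integral_const_mul, hW.covariance, hg, sum_inner, inner_smul_left]
    simp
  have hsq : ∫ ω, (W g ω - ∑ i ∈ s, a i * W (h i) ω) ^ 2 ∂P = 0 := by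
    have hi : ∀ k, Integrable (fun ω => (W g ω - ∑ i ∈ s, a i * W (h i) ω) * W k ω) P :=
      fun k => hmem.integrable_mul (hW.memLp_two k)
    have e : ∀ ω, (W g ω - ∑ i ∈ s, a i * W (h i) ω) ^ 2
        = (W g ω - ∑ i ∈ s, a i * W (h i) ω) * W g ω
          - ∑ j ∈ s, a j * ((W g ω - ∑ i ∈ s, a i * W (h i) ω) * W (h j) ω) := fun ω => by
      rw [sq, mul_sub _ (W g ω), Finset.mul_sum]
      congr 1
      exact Finset.sum_congr rfl fun j _ => by ring
    simp only [e]
    rw [integral_sub (hi g) (integrable_finsetSum s fun j _ => (hi (h j)).const_mul (a j)),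
      integral_finsetSum s fun j _ => (hi (h j)).const_mul (a j)]
    simp [integral_const_mul, hzero]
  rw [integral_eq_zero_iff_of_nonneg (fun ω => sq_nonneg _) hmem.integrable_sq] at hsq
  filter_upwards [hsq] with ω hω
  have : W g ω - ∑ i ∈ s, a i * W (h i) ω = 0 := by simpa using hω
  linarith

/-- A linear functional of the vector is almost surely `W` of a single element, hence Gaussian; this
upgrades marginal to joint Gaussianity, which independence requires. -/
theorem hasGaussianLaw_pi (hW : IsWhiteNoise P W) {ι : Type*} [Fintype ι] (h : ι → L2Interval) :
    HasGaussianLaw (fun ω i => W (h i) ω) P := by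
  classical
  have hm : Measurable fun ω i => W (h i) ω := measurable_pi_lambda _ fun i => hW.measurable (h i)
  refine ⟨isGaussian_of_isGaussian_map fun L => ?_⟩
  rw [Measure.map_map (by fun_prop) hm]
  have e : L ∘ (fun ω i => W (h i) ω) =ᵐ[P] W (∑ i, L (Pi.single i 1) • h i) := by
    filter_upwards [hW.ae_eq_sum Finset.univ (fun i => L (Pi.single i 1)) h] with ω hω
    rw [hω, Function.comp_apply]
    conv_lhs => rw [pi_eq_sum_univ' (fun i => W (h i) ω), map_sum]
    refine Finset.sum_congr rfl fun i _ => ?_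
    rw [map_smul, smul_eq_mul, mul_comm]
  rw [Measure.map_congr e]
  exact (hW.gaussian _).isGaussian_map

theorem iIndepFun_of_orthogonal [IsProbabilityMeasure P] (hW : IsWhiteNoise P W) {ι : Type*}
    [Fintype ι] (h : ι → L2Interval) (horth : ∀ i j, i ≠ j → inner ℝ (h i) (h j) = 0) :
    iIndepFun (fun i => W (h i)) P := by
  refine (hW.hasGaussianLaw_pi h).iIndepFun_of_covariance_eq_zero fun i j hij => ?_
  rw [covariance_eq_sub (hW.memLp_two _) (hW.memLp_two _), hW.mean_zero, hW.mean_zero]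
  simpa [horth i j hij] using hW.covariance (h i) (h j)

theorem map_eq_gaussianReal [IsProbabilityMeasure P] (hW : IsWhiteNoise P W) (h : L2Interval)
    (hh : ‖h‖ = 1) : P.map (W h) = gaussianReal 0 1 := by
  rw [(hW.gaussian h).map_eq_gaussianReal, hW.mean_zero,
    variance_of_integral_eq_zero (hW.measurable h).aemeasurable (hW.mean_zero h)]
  have := hW.covariance h h
  rw [real_inner_self_eq_norm_sq, hh] at this
  simp only [sq, this]
  simp

end IsWhiteNoise

/-! ### The cosine basis: orthonormality, Bessel, completeness -/

theorem setIntegral_Ioo_eq_intervalIntegral {a b : ℝ} (hab : a ≤ b) (f : ℝ → ℝ) :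
    ∫ x in Ioo a b, f x = ∫ x in a..b, f x := by
  rw [intervalIntegral.integral_of_le hab, integral_Ioc_eq_integral_Ioo]

theorem integral_cos_natCast_mul (n : ℕ) :
    ∫ x in Ioo 0 Real.pi, Real.cos (n * x) = if n = 0 then Real.pi else 0 := by
  rw [setIntegral_Ioo_eq_intervalIntegral Real.pi_pos.le]
  split_ifs with h
  · simp [h]
  · have hn : (n : ℝ) ≠ 0 := by exact_mod_cast h
    rw [intervalIntegral.integral_comp_mul_left _ hn]
    simp [Real.sin_nat_mul_pi]

theorem integral_cos_mul_cos (j k : ℕ) :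
    ∫ x in Ioo 0 Real.pi, Real.cos (j * x) * Real.cos (k * x)
      = if j = k then (if j = 0 then Real.pi else Real.pi / 2) else 0 := by
  wlog hjk : k ≤ j generalizing j k
  · have := this k j (by omega)
    simp only [mul_comm (Real.cos (k * _))] at this
    rw [this]
    rcases eq_or_ne j k with h | h
    · simp [h]
    · simp [h, h.symm]
  have hint : ∀ n : ℕ, IntegrableOn (fun x => Real.cos (n * x)) (Ioo 0 Real.pi) := fun n =>
    ((show Continuous fun x : ℝ => Real.cos (n * x) by fun_prop).integrableOn_Icc).mono_set
      Ioo_subset_Icc_self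
  have e : ∀ x : ℝ, Real.cos (j * x) * Real.cos (k * x)
      = (1 / 2) * Real.cos ((j - k : ℕ) * x) + (1 / 2) * Real.cos ((j + k : ℕ) * x) := fun x => by
    rw [Nat.cast_sub hjk, Nat.cast_add, sub_mul, add_mul, Real.cos_sub, Real.cos_add]
    ring
  simp only [e]
  rw [integral_add ((hint _).const_mul _) ((hint _).const_mul _), integral_const_mul,
    integral_const_mul, integral_cos_natCast_mul, integral_cos_natCast_mul]
  rcases eq_or_ne j k with h | h
  · subst h
    rcases eq_or_ne j 0 with h0 | h0
    · simp [h0]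
      ring
    · simp [h0]
      ring
  · have h1 : j - k ≠ 0 := by omega
    have h2 : j + k ≠ 0 := by omega
    simp only [h1, h2, h, if_false]
    ring

/-- The normalizing constant is the value at `0`, which removes the case distinction at `k = 0`. -/
theorem cosBasis_eq (k : ℕ) (x : ℝ) : cosBasis k x = cosBasis k 0 * Real.cos (k * x) := by
  unfold cosBasis
  split_ifs with h <;> simp [h]

theorem cosBasis_zero_pos (k : ℕ) : 0 < cosBasis k 0 := by
  unfold cosBasis
  split_ifs
  · positivity
  · simp only [mul_zero, Real.cos_zero]
    positivity

theorem cosBasis_zero_le_one (k : ℕ) : cosBasis k 0 ≤ 1 := by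
  have hpi := Real.pi_gt_three
  unfold cosBasis
  split_ifs
  · rw [div_le_one (by positivity)]
    exact Real.one_le_sqrt.2 (by linarith)
  · simp only [mul_zero, Real.cos_zero, mul_one]
    refine Real.sqrt_le_one.2 ((div_le_one (by positivity)).2 ?_)
    linarith

theorem abs_cosBasis_le_one (k : ℕ) (x : ℝ) : |cosBasis k x| ≤ 1 := by
  rw [cosBasis_eq, abs_mul, abs_of_pos (cosBasis_zero_pos k)]
  exact mul_le_one₀ (cosBasis_zero_le_one k) (abs_nonneg _) (Real.abs_cos_le_one _)

theorem integral_cosBasis_mul_cosBasis (j k : ℕ) :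
    ∫ x in Ioo 0 Real.pi, cosBasis j x * cosBasis k x = if j = k then 1 else 0 := by
  have e : ∀ x, cosBasis j x * cosBasis k x
      = (cosBasis j 0 * cosBasis k 0) * (Real.cos (j * x) * Real.cos (k * x)) := fun x => by
    rw [cosBasis_eq j x, cosBasis_eq k x]
    ring
  rw [integral_congr_ae (ae_of_all _ e), integral_const_mul, integral_cos_mul_cos]
  rcases eq_or_ne j k with h | h
  · subst h
    have hpi : (0 : ℝ) < Real.pi := Real.pi_pos
    rcases eq_or_ne j 0 with h0 | h0
    · simp only [h0, cosBasis, if_true]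
      rw [div_mul_div_comm, Real.mul_self_sqrt hpi.le]
      field_simp
    · simp only [h0, cosBasis, if_true, if_false, mul_zero, Real.cos_zero, mul_one]
      rw [Real.mul_self_sqrt (by positivity)]
      field_simp
  · simp [h]

theorem orthonormal_cosBasisL2 : Orthonormal ℝ cosBasisL2 := by
  rw [orthonormal_iff_ite]
  intro i j
  rw [L2.inner_def, ← integral_cosBasis_mul_cosBasis i j]
  refine integral_congr_ae ?_
  filter_upwards [(memLp_cosBasis i).coeFn_toLp, (memLp_cosBasis j).coeFn_toLp] with x hi hj
  simp only [cosBasisL2, hi, hj, RCLike.inner_apply, conj_trivial]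
  ring

/-- Bessel's inequality for the cosine basis. -/
theorem sum_sq_integral_mul_cosBasis_le (f : ℝ → ℝ) (hf : MemLp f 2 intervalMeasure)
    (s : Finset ℕ) :
    ∑ j ∈ s, (∫ x in Ioo 0 Real.pi, f x * cosBasis j x) ^ 2 ≤ ∫ x in Ioo 0 Real.pi, f x ^ 2 := by
  have h := orthonormal_cosBasisL2.sum_inner_products_le (hf.toLp f) (s := s)
  have h1 : ∀ j, ‖inner ℝ (cosBasisL2 j) (hf.toLp f)‖ ^ 2
      = (∫ x in Ioo 0 Real.pi, f x * cosBasis j x) ^ 2 := fun j => by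
    rw [L2.inner_def, Real.norm_eq_abs, sq_abs]
    congr 1
    refine integral_congr_ae ?_
    filter_upwards [(memLp_cosBasis j).coeFn_toLp, hf.coeFn_toLp] with x hi hj
    simp only [cosBasisL2, hi, hj, RCLike.inner_apply, conj_trivial]
  have h2 : ‖hf.toLp f‖ ^ 2 = ∫ x in Ioo 0 Real.pi, f x ^ 2 := by
    rw [← real_inner_self_eq_norm_sq, L2.inner_def]
    refine integral_congr_ae ?_
    filter_upwards [hf.coeFn_toLp] with x hj
    simp only [hj, RCLike.inner_apply, conj_trivial, sq]
  simpa only [h1, h2] using h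

theorem integrableOn_mul_cosBasis {f : ℝ → ℝ} (hf : IntegrableOn f (Ioo 0 Real.pi)) (k : ℕ) :
    IntegrableOn (fun x => f x * cosBasis k x) (Ioo 0 Real.pi) :=
  Integrable.mul_bdd (c := 1) hf (continuous_cosBasis k).aestronglyMeasurable
    (Eventually.of_forall fun x => abs_cosBasis_le_one k x)

theorem integral_sum_cosBasis_sq (s : Finset ℕ) (c : ℕ → ℝ) :
    ∫ x in Ioo 0 Real.pi, (∑ k ∈ s, c k * cosBasis k x) ^ 2 = ∑ k ∈ s, c k ^ 2 := by
  have hi : ∀ j k, IntegrableOn (fun x => cosBasis j x * cosBasis k x) (Ioo 0 Real.pi) :=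
    fun j k => ((show Continuous fun x => cosBasis j x * cosBasis k x from
      (continuous_cosBasis j).mul (continuous_cosBasis k)).integrableOn_Icc).mono_set
        Ioo_subset_Icc_self
  have e : ∀ x, (∑ k ∈ s, c k * cosBasis k x) ^ 2
      = ∑ j ∈ s, ∑ k ∈ s, (c j * c k) * (cosBasis j x * cosBasis k x) := fun x => by
    rw [sq, Finset.sum_mul_sum]
    exact Finset.sum_congr rfl fun j _ => Finset.sum_congr rfl fun k _ => by ring
  simp only [e]
  rw [integral_finsetSum s fun j _ => integrable_finsetSum s fun k _ => (hi j k).const_mul _]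
  refine Finset.sum_congr rfl fun j hj => ?_
  rw [integral_finsetSum s fun k _ => (hi j k).const_mul _]
  simp [integral_const_mul, integral_cosBasis_mul_cosBasis, hj, sq]

/-- A continuous function on `[0, π]` orthogonal to all cosines vanishes. -/
theorem eq_zero_of_integral_mul_cosBasis_eq_zero {g : ℝ → ℝ} (hg : ContinuousOn g (Icc 0 Real.pi))
    (h : ∀ k, ∫ x in Ioo 0 Real.pi, g x * cosBasis k x = 0) :
    ∀ x ∈ Icc 0 Real.pi, g x = 0 := by
  have hgi : IntegrableOn g (Ioo 0 Real.pi) := hg.integrableOn_Icc.mono_set Ioo_subset_Icc_self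
  have hmul : ∀ c : ℝ → ℝ, Continuous c → IntegrableOn (fun x => g x * c x) (Ioo 0 Real.pi) :=
    fun c hc => (hg.mul hc.continuousOn).integrableOn_Icc.mono_set Ioo_subset_Icc_self
  -- The product formula for `cos x * cos (k x)` trades a power of `cos x` for a shift of frequency,
  -- so `g` is orthogonal to every polynomial in `cos x`.
  have hcos : ∀ n k : ℕ, ∫ x in Ioo 0 Real.pi, g x * (Real.cos x ^ n * Real.cos (k * x)) = 0 := by
    intro n
    induction n with
    | zero =>
      intro k
      have := h k
      rw [integral_congr_ae (ae_of_all _ fun x => show g x * cosBasis k x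
        = cosBasis k 0 * (g x * Real.cos (k * x)) by rw [cosBasis_eq]; ring), integral_const_mul,
        mul_eq_zero, or_iff_right (cosBasis_zero_pos k).ne'] at this
      simpa using this
    | succ n ih =>
      intro k
      rcases k with _ | k
      · simpa [pow_succ] using ih 1
      · have e : ∀ x : ℝ, g x * (Real.cos x ^ (n + 1) * Real.cos ((k + 1 : ℕ) * x))
            = (1 / 2) * (g x * (Real.cos x ^ n * Real.cos ((k + 2 : ℕ) * x)))
              + (1 / 2) * (g x * (Real.cos x ^ n * Real.cos (k * x))) := fun x => by
          have h1 : ((k + 2 : ℕ) : ℝ) * x = (k + 1 : ℕ) * x + x := by push_cast; ring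
          have h2 : (k : ℝ) * x = (k + 1 : ℕ) * x - x := by push_cast; ring
          rw [h1, h2, Real.cos_add, Real.cos_sub]
          ring
        simp only [e]
        rw [integral_add ((hmul _ (by fun_prop)).const_mul _) ((hmul _ (by fun_prop)).const_mul _),
          integral_const_mul, integral_const_mul, ih, ih]
        ring
  have hpoly : ∀ p : Polynomial ℝ, ∫ x in Ioo 0 Real.pi, g x * p.eval (Real.cos x) = 0 := fun p => by
    simp only [Polynomial.eval_eq_sum_range, Finset.mul_sum, mul_left_comm (g _)]
    rw [integral_finsetSum _ fun n _ => (hmul _ (by fun_prop)).const_mul _]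
    refine Finset.sum_eq_zero fun n _ => ?_
    rw [integral_const_mul]
    simpa using Or.inr (hcos n 0)
  have hsq : ∫ x in Ioo 0 Real.pi, g x ^ 2 = 0 := by
    have hsi : IntegrableOn (fun x => g x ^ 2) (Ioo 0 Real.pi) :=
      (hg.pow 2).integrableOn_Icc.mono_set Ioo_subset_Icc_self
    -- Weierstrass for `g ∘ arccos` on `[-1, 1]` gives a polynomial in `cos x` uniformly `ε`-close
    -- to `g`; being orthogonal to `g`, it can be subtracted inside `∫ g²`.
    have hle : ∀ ε > 0, ∫ x in Ioo 0 Real.pi, g x ^ 2 ≤ ε * ∫ x in Ioo 0 Real.pi, |g x| := by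
      intro ε hε
      have hc : ContinuousOn (fun y => g (Real.arccos y)) (Icc (-1) 1) :=
        hg.comp Real.continuous_arccos.continuousOn fun y _ =>
          ⟨Real.arccos_nonneg y, Real.arccos_le_pi y⟩
      obtain ⟨p, hp⟩ := exists_polynomial_near_of_continuousOn (-1) 1 _ hc ε hε
      have hpc := hmul (fun x => p.eval (Real.cos x)) (by fun_prop)
      calc ∫ x in Ioo 0 Real.pi, g x ^ 2
          = ∫ x in Ioo 0 Real.pi, (g x ^ 2 - g x * p.eval (Real.cos x)) := by
            rw [integral_sub hsi hpc, hpoly, sub_zero]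
        _ ≤ ∫ x in Ioo 0 Real.pi, ε * |g x| := by
            refine setIntegral_mono_on (hsi.sub hpc) (hgi.abs.const_mul ε) measurableSet_Ioo ?_
            intro x hx
            have h1 := hp (Real.cos x) (Real.cos_mem_Icc x)
            rw [Real.arccos_cos hx.1.le hx.2.le] at h1
            calc g x ^ 2 - g x * p.eval (Real.cos x) = -(g x * (p.eval (Real.cos x) - g x)) := by ring
              _ ≤ |g x * (p.eval (Real.cos x) - g x)| := neg_le_abs _
              _ ≤ ε * |g x| := by
                rw [abs_mul, mul_comm]
                exact mul_le_mul_of_nonneg_right h1.le (abs_nonneg _)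
        _ = _ := integral_const_mul _ _
    have hI : 0 ≤ ∫ x in Ioo 0 Real.pi, |g x| := integral_nonneg fun x => abs_nonneg _
    refine le_antisymm (le_of_forall_pos_le_add fun δ hδ => ?_) (integral_nonneg fun x => sq_nonneg _)
    refine (hle (δ / (1 + ∫ x in Ioo 0 Real.pi, |g x|)) (by positivity)).trans ?_
    rw [zero_add, div_mul_eq_mul_div, div_le_iff₀ (by positivity)]
    nlinarith
  have hae : g =ᵐ[volume.restrict (Icc 0 Real.pi)] 0 := by
    rw [← restrict_Ioo_eq_restrict_Icc]
    rw [integral_eq_zero_iff_of_nonneg (fun x => sq_nonneg _)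
      ((hg.pow 2).integrableOn_Icc.mono_set Ioo_subset_Icc_self)] at hsq
    filter_upwards [hsq] with x hx
    simpa using hx
  exact fun x hx => Measure.eqOn_Icc_of_ae_eq volume Real.pi_pos.ne hae hg continuousOn_const hx

/-! ### The Cameron–Martin basis and chaos series -/

/-- The normalized (probabilists') Hermite polynomial as a function. -/
noncomputable def normHermite (n : ℕ) (x : ℝ) : ℝ :=
  Polynomial.aeval x (Polynomial.hermite n) / √(n.factorial : ℝ)

theorem continuous_normHermite (n : ℕ) : Continuous (normHermite n) :=
  (Polynomial.continuous_aeval _).div_const _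

theorem integral_normHermite_mul (m n : ℕ) :
    ∫ x, normHermite m x * normHermite n x ∂gaussianReal 0 1 = if m = n then 1 else 0 := by
  have e : ∀ x, normHermite m x * normHermite n x
      = (√(m.factorial : ℝ) * √(n.factorial : ℝ))⁻¹
        * (Polynomial.aeval x (Polynomial.hermite m) * Polynomial.aeval x (Polynomial.hermite n)) :=
    fun x => by
      unfold normHermite
      field_simp
  rw [integral_congr_ae (ae_of_all _ e), integral_const_mul,
    integral_hermite_mul_hermite_gaussianReal]
  split_ifs with h
  · subst h
    rw [Real.mul_self_sqrt (by positivity), inv_mul_cancel₀ (by positivity)]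
  · simp

theorem memLp_normHermite (n : ℕ) : MemLp (normHermite n) 2 (gaussianReal 0 1) := by
  have := (memLp_eval_gaussianReal ((Polynomial.hermite n).map (algebraMap ℤ ℝ))).const_mul
    (√(n.factorial : ℝ))⁻¹
  refine this.ae_eq (ae_of_all _ fun x => ?_)
  simp only [normHermite, Polynomial.eval_map_algebraMap]
  ring

/-- Factors outside the support are `He_0 = 1`. Enlarging the index set lets two multi-indices share
one finite family of Gaussians. -/
theorem chaosBasis_eq_prod {Ω : Type*} (W : L2Interval → Ω → ℝ) {α : MultiIdx} {s : Finset ℕ}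
    (hs : α.support ⊆ s) (ω : Ω) :
    chaosBasis W α ω = ∏ k : s, normHermite (α k) (W (cosBasisL2 k) ω) := by
  rw [Finset.prod_coe_sort s fun k => normHermite (α k) (W (cosBasisL2 k) ω)]
  refine Finset.prod_subset hs fun k _ hk => ?_
  rw [Finsupp.notMem_support_iff.1 hk]
  simp

theorem measurable_chaosBasis {Ω : Type*} (W : L2Interval → Ω → ℝ) (α : MultiIdx) :
    Measurable[noiseSigma W] (chaosBasis W α) := by
  have h : ∀ g, Measurable[noiseSigma W] (W g) := fun g => by
    rw [measurable_iff_comap_le, BorelSpace.measurable_eq (α := ℝ)]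
    exact le_iSup (fun g => MeasurableSpace.comap (W g) (borel ℝ)) g
  have e : chaosBasis W α
      = fun ω => ∏ k : α.support, normHermite (α k) (W (cosBasisL2 k) ω) :=
    funext fun ω => chaosBasis_eq_prod W subset_rfl ω
  rw [e]
  exact Finset.measurable_fun_prod _ fun k _ => (continuous_normHermite _).measurable.comp (h _)

namespace IsWhiteNoise

variable {Ω : Type*} [MeasurableSpace Ω] {P : Measure Ω} {W : L2Interval → Ω → ℝ}

theorem noiseSigma_le (hW : IsWhiteNoise P W) : noiseSigma W ≤ ‹MeasurableSpace Ω› :=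
  iSup_le fun h => by
    rw [← BorelSpace.measurable_eq (α := ℝ)]
    exact (hW.measurable h).comap_le

variable [IsProbabilityMeasure P]

theorem iIndepFun_cosBasisL2 (hW : IsWhiteNoise P W) (s : Finset ℕ) :
    iIndepFun (fun k : s => W (cosBasisL2 k)) P :=
  hW.iIndepFun_of_orthogonal _ fun _ _ hij =>
    orthonormal_cosBasisL2.2 fun h => hij (Subtype.ext h)

theorem map_cosBasisL2 (hW : IsWhiteNoise P W) (k : ℕ) :
    P.map (W (cosBasisL2 k)) = gaussianReal 0 1 :=
  hW.map_eq_gaussianReal _ (orthonormal_cosBasisL2.1 k)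

/-- Independence factors the expectation into one-dimensional Hermite integrals; a mode where `α`
and `β` differ lies in the union of supports and contributes a zero factor. -/
theorem integral_chaosBasis_mul (hW : IsWhiteNoise P W) (α β : MultiIdx) :
    ∫ ω, chaosBasis W α ω * chaosBasis W β ω ∂P = if α = β then 1 else 0 := by
  set s := α.support ∪ β.support with hs
  have e : ∀ ω, chaosBasis W α ω * chaosBasis W β ω
      = ∏ k : s, (fun x => normHermite (α k) x * normHermite (β k) x) (W (cosBasisL2 k) ω) :=
    fun ω => by
      rw [chaosBasis_eq_prod W (s := s) Finset.subset_union_left,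
        chaosBasis_eq_prod W (s := s) Finset.subset_union_right, ← Finset.prod_mul_distrib]
  have hc : ∀ k, Continuous fun x => normHermite (α k) x * normHermite (β k) x := fun k =>
    (continuous_normHermite _).mul (continuous_normHermite _)
  rw [integral_congr_ae (ae_of_all _ e), (hW.iIndepFun_cosBasisL2 s).integral_fun_prod_comp
    (f := fun (k : s) x => normHermite (α k) x * normHermite (β k) x)
    (fun k => (hW.measurable _).aemeasurable) (fun k => (hc k).aestronglyMeasurable)]
  have e2 : ∀ k : s, ∫ ω, normHermite (α k) (W (cosBasisL2 k) ω)
      * normHermite (β k) (W (cosBasisL2 k) ω) ∂P = if α k = β k then 1 else 0 := fun k => by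
    rw [← integral_normHermite_mul, ← hW.map_cosBasisL2 k,
      integral_map (hW.measurable _).aemeasurable (hc k).aestronglyMeasurable]
  simp only [e2]
  split_ifs with h
  · simp [h]
  · obtain ⟨k, hk⟩ := DFunLike.ne_iff.1 h
    have hks : k ∈ s := by
      rw [hs, Finset.mem_union, Finsupp.mem_support_iff, Finsupp.mem_support_iff]
      omega
    exact Finset.prod_eq_zero (Finset.mem_univ ⟨k, hks⟩) (if_neg hk)

theorem memLp_chaosBasis (hW : IsWhiteNoise P W) (α : MultiIdx) : MemLp (chaosBasis W α) 2 P := by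
  have hm : Measurable (chaosBasis W α) := (measurable_chaosBasis W α).mono hW.noiseSigma_le le_rfl
  rw [memLp_two_iff_integrable_sq hm.aestronglyMeasurable]
  have e : ∀ ω, chaosBasis W α ω ^ 2
      = ∏ k : α.support, (fun x => normHermite (α k) x ^ 2) (W (cosBasisL2 k) ω) := fun ω => by
    rw [chaosBasis_eq_prod W subset_rfl, Finset.prod_pow]
  simp only [e]
  have hpi := (hW.iIndepFun_cosBasisL2 α.support).map_fun_eq_pi_map
    fun k => (hW.measurable _).aemeasurable
  have hi : Integrable (fun x : α.support → ℝ => ∏ k : α.support, normHermite (α k) (x k) ^ 2)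
      (Measure.pi fun k : α.support => P.map (W (cosBasisL2 k))) := by
    refine Integrable.fintype_prod (f := fun (k : α.support) x => normHermite (α k) x ^ 2) fun k => ?_
    rw [hW.map_cosBasisL2]
    exact (memLp_normHermite _).integrable_sq
  rw [← hpi] at hi
  exact hi.comp_measurable (measurable_pi_lambda _ fun k => hW.measurable _)

/-- A family of coefficients that decays fast enough is the family of chaos coefficients of an
element of all the spaces `L_{2,q}`. -/
theorem exists_isChaosSum (hW : IsWhiteNoise P W) (c : MultiIdx → ℝ)
    (hc : ∀ q : ℝ, 1 < q → Summable fun α : MultiIdx => q ^ α.degree * c α ^ 2) :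
    ∃ v : Ω → ℝ, IsChaosSum P W c v ∧ (∀ α, chaosCoeff P W v α = c α) ∧
      ∀ q : ℝ, 1 < q → MemL2q P W q v := by
  have hm := hW.noiseSigma_le
  have hsm : ∀ α, StronglyMeasurable[noiseSigma W] (chaosBasis W α) := fun α =>
    (measurable_chaosBasis W α).stronglyMeasurable
  -- Any `q > 1` would do: the weight `q ^ |α|` is at least one.
  have hc2 : Summable fun α => c α ^ 2 := by
    refine (hc 2 one_lt_two).of_nonneg_of_le (fun α => sq_nonneg _) fun α => ?_
    exact le_mul_of_one_le_left (sq_nonneg _) (one_le_pow₀ one_le_two)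
  -- The series is summed in `L²` of the trimmed measure, so that the limit is measurable with
  -- respect to the noise and not merely almost everywhere equal to such a variable.
  obtain ⟨v, hvm, hv2, hv⟩ := @exists_tendsto_sum_of_orthonormal Ω MultiIdx (noiseSigma W) _
    (P.trim hm) (chaosBasis W)
    (fun α => ⟨(hsm α).aestronglyMeasurable, by
      rw [eLpNorm_trim hm (hsm α)]
      exact (hW.memLp_chaosBasis α).2⟩)
    (fun α β => by
      refine Eq.trans ?_ (hW.integral_chaosBasis_mul α β)
      exact (integral_trim hm ((hsm α).mul (hsm β))).symm) c hc2
  have hv2' : MemLp v 2 P := memLp_of_memLp_trim hm hv2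
  have hsum : IsChaosSum P W c v := by
    refine hv.congr fun s => eLpNorm_trim hm ?_
    exact hvm.sub (Finset.stronglyMeasurable_fun_sum s fun α _ => (hsm α).const_mul (c α))
  have hcoeff : ∀ β, chaosCoeff P W v β = c β := by
    intro β
    -- Once `β ∈ s`, the error in the coefficient is the inner product of the remainder with the
    -- unit vector `ξ_β`; Cauchy–Schwarz bounds it by the norm of the remainder.
    have hpart : ∀ s : Finset MultiIdx, β ∈ s →
        |chaosCoeff P W v β - c β|
          ≤ (eLpNorm (fun ω => v ω - ∑ α ∈ s, c α * chaosBasis W α ω) 2 P).toReal := by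
      intro s hs
      set r : Ω → ℝ := fun ω => v ω - ∑ α ∈ s, c α * chaosBasis W α ω with hr
      have hsumLp : MemLp (fun ω => ∑ α ∈ s, c α * chaosBasis W α ω) 2 P :=
        memLp_finsetSum s fun α _ => (hW.memLp_chaosBasis α).const_mul (c α)
      have hrLp : MemLp r 2 P := hv2'.sub hsumLp
      have e : chaosCoeff P W v β - c β = ∫ ω, r ω * chaosBasis W β ω ∂P := by
        have hi : ∀ α, Integrable (fun ω => chaosBasis W α ω * chaosBasis W β ω) P := fun α =>
          (hW.memLp_chaosBasis α).integrable_mul (hW.memLp_chaosBasis β)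
        simp only [hr, sub_mul, Finset.sum_mul, mul_assoc]
        have hvi : Integrable (fun ω => v ω * chaosBasis W β ω) P :=
          hv2'.integrable_mul (hW.memLp_chaosBasis β)
        rw [integral_sub hvi
          (integrable_finsetSum s fun α _ => (hi α).const_mul _),
          integral_finsetSum s fun α _ => (hi α).const_mul _]
        simp [integral_const_mul, hW.integral_chaosBasis_mul, hs, chaosCoeff]
      have h1 := norm_inner_le_norm (𝕜 := ℝ) (hrLp.toLp r)
        ((hW.memLp_chaosBasis β).toLp (chaosBasis W β))
      have h2 : inner ℝ (hrLp.toLp r) ((hW.memLp_chaosBasis β).toLp (chaosBasis W β))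
          = ∫ ω, r ω * chaosBasis W β ω ∂P := by
        rw [L2.inner_def]
        refine integral_congr_ae ?_
        filter_upwards [hrLp.coeFn_toLp, (hW.memLp_chaosBasis β).coeFn_toLp] with x hi hj
        simp only [hi, hj, RCLike.inner_apply, conj_trivial]
        ring
      have h3 : ‖(hW.memLp_chaosBasis β).toLp (chaosBasis W β)‖ = 1 := by
        rw [← sq_eq_sq₀ (norm_nonneg _) zero_le_one, ← real_inner_self_eq_norm_sq, L2.inner_def,
          one_pow, ← if_pos (c := β = β) (t := (1 : ℝ)) (e := 0) rfl,
          ← hW.integral_chaosBasis_mul β β]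
        refine integral_congr_ae ?_
        filter_upwards [(hW.memLp_chaosBasis β).coeFn_toLp] with x hj
        simp only [hj, RCLike.inner_apply, conj_trivial]
      rw [h2, h3, mul_one, Lp.norm_toLp] at h1
      rw [e]
      exact h1
    have hlim : Tendsto (fun s : Finset MultiIdx =>
        (eLpNorm (fun ω => v ω - ∑ α ∈ s, c α * chaosBasis W α ω) 2 P).toReal) atTop (𝓝 0) :=
      (ENNReal.tendsto_toReal ENNReal.zero_ne_top).comp hsum
    have hle : |chaosCoeff P W v β - c β| ≤ 0 := by
      refine ge_of_tendsto hlim ?_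
      filter_upwards [eventually_ge_atTop {β}] with s hs
      exact hpart s (hs (Finset.mem_singleton_self β))
    exact sub_eq_zero.1 (abs_nonpos_iff.1 hle)
  refine ⟨v, hsum, hcoeff, fun q hq => ⟨hvm.measurable, hv2', ?_⟩⟩
  simpa only [hcoeff] using hc q hq

end IsWhiteNoise

/-! ### The explicit solution and the class of tame functions -/

/-- The Fourier cosine coefficient of a function on `(0, π)`. -/
noncomputable def cosCoeff (f : ℝ → ℝ) (k : ℕ) : ℝ := ∫ x in Ioo 0 Real.pi, f x * cosBasis k x

/-- The sum of a cosine series. -/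
noncomputable def cosSeries (a : ℕ → ℝ) (x : ℝ) : ℝ := ∑' k, a k * cosBasis k x

/-- The cosine coefficients of the mild solution of the heat equation with source `F` and zero
initial condition. -/
noncomputable def duhamelCoeff (F : ℝ → ℝ → ℝ) (k : ℕ) (t : ℝ) : ℝ :=
  ∫ s in Ioo 0 t, Real.exp (-((k : ℝ) ^ 2 * (t - s))) * cosCoeff (F s) k

/-- The source term of the propagator. -/
noncomputable def chaosSource (v : MultiIdx → ℝ → ℝ → ℝ) (α : MultiIdx) (s x : ℝ) : ℝ :=
  ∑ k ∈ α.support, √(α k : ℝ) * cosBasis k x * v (α - Finsupp.single k 1) s x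

/-- The solution of the propagator for multi-indices of degree `n`. -/
noncomputable def chaosLevel (u₀ : ℝ → ℝ) : ℕ → MultiIdx → ℝ → ℝ → ℝ
  | 0, _, t, x => if 0 < t then
      cosSeries (fun k => Real.exp (-((k : ℝ) ^ 2 * t)) * cosCoeff u₀ k) x else 0
  | n + 1, α, t, x => cosSeries (fun k => duhamelCoeff (chaosSource (chaosLevel u₀ n) α) k t) x

/-- The chaos solution. -/
noncomputable def chaosSolution (u₀ : ℝ → ℝ) (α : MultiIdx) : ℝ → ℝ → ℝ := chaosLevel u₀ α.degree α

/-- A jointly measurable function of time and space whose spatial supremum is `O(t ^ (-3/4))`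
locally uniformly in time. -/
structure IsTame (v : ℝ → ℝ → ℝ) : Prop where
  measurable : Measurable (Function.uncurry v)
  bound : ∀ T > 0, ∃ C : ℝ, ∀ s, 0 < s → s ≤ T → ∀ y, |v s y| ≤ C * s ^ (-(3 / 4) : ℝ)

theorem integrableOn_rpow_Ioo {a : ℝ} (ha : -1 < a) {t : ℝ} (ht : 0 < t) :
    IntegrableOn (fun s : ℝ => s ^ a) (Ioo 0 t) :=
  (intervalIntegral.integrableOn_Ioo_rpow_iff ht).2 ha

theorem abs_cosCoeff_le {f : ℝ → ℝ} {C : ℝ} (hf : ∀ x, |f x| ≤ C) (k : ℕ) :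
    |cosCoeff f k| ≤ C * Real.pi := by
  have := norm_setIntegral_le_of_norm_le_const (μ := volume) (s := Ioo 0 Real.pi) (C := C)
    (f := fun x => f x * cosBasis k x) (by simp) fun x _ => by
      rw [norm_mul, Real.norm_eq_abs, Real.norm_eq_abs]
      exact (mul_le_of_le_one_right (abs_nonneg _) (abs_cosBasis_le_one k x)).trans (hf x)
  simpa [cosCoeff, Real.pi_pos.le] using this

namespace IsTame

variable {v w : ℝ → ℝ → ℝ}

theorem measurable_right (hv : IsTame v) (s : ℝ) : Measurable (v s) :=
  hv.measurable.comp measurable_prodMk_left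

theorem zero : IsTame fun _ _ => 0 :=
  ⟨measurable_const, fun _ _ => ⟨0, fun _ _ _ _ => by simp⟩⟩

theorem add (hv : IsTame v) (hw : IsTame w) : IsTame fun s x => v s x + w s x := by
  refine ⟨hv.measurable.add hw.measurable, fun T hT => ?_⟩
  obtain ⟨C, hC⟩ := hv.bound T hT
  obtain ⟨D, hD⟩ := hw.bound T hT
  refine ⟨C + D, fun s h0 hs y => (abs_add_le _ _).trans ?_⟩
  rw [add_mul]
  exact add_le_add (hC s h0 hs y) (hD s h0 hs y)

theorem sum {ι : Type*} (S : Finset ι) {f : ι → ℝ → ℝ → ℝ} (hf : ∀ i ∈ S, IsTame (f i)) :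
    IsTame fun s x => ∑ i ∈ S, f i s x := by
  classical
  induction S using Finset.induction_on with
  | empty => simpa using zero
  | insert i S hi ih =>
    simp only [Finset.sum_insert hi]
    exact (hf i (Finset.mem_insert_self i S)).add
      (ih fun j hj => hf j (Finset.mem_insert_of_mem hj))

theorem bdd_mul (hv : IsTame v) {b : ℝ → ℝ} (hb : Measurable b) {D : ℝ} (hD : ∀ x, |b x| ≤ D) :
    IsTame fun s x => b x * v s x := by
  refine ⟨(hb.comp measurable_snd).mul hv.measurable, fun T hT => ?_⟩
  obtain ⟨C, hC⟩ := hv.bound T hT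
  refine ⟨D * C, fun s h0 hs y => ?_⟩
  rw [abs_mul, mul_assoc]
  exact mul_le_mul (hD y) (hC s h0 hs y) (abs_nonneg _) ((abs_nonneg _).trans (hD y))

theorem chaosSource {u : MultiIdx → ℝ → ℝ → ℝ} (α : MultiIdx)
    (hu : ∀ k ∈ α.support, IsTame (u (α - Finsupp.single k 1))) : IsTame (chaosSource u α) := by
  refine sum _ fun k hk => (hu k hk).bdd_mul (D := √(α k : ℝ))
    (measurable_const.mul (continuous_cosBasis k).measurable) fun x => ?_
  rw [abs_mul, abs_of_nonneg (Real.sqrt_nonneg _)]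
  exact mul_le_of_le_one_right (Real.sqrt_nonneg _) (abs_cosBasis_le_one k x)

theorem memLp (hv : IsTame v) {s : ℝ} (hs : 0 < s) (p : ℝ≥0∞) : MemLp (v s) p intervalMeasure := by
  obtain ⟨C, hC⟩ := hv.bound s hs
  exact MemLp.of_bound (hv.measurable_right s).aestronglyMeasurable _
    (Eventually.of_forall fun y => hC s hs le_rfl y)

theorem integrableOn (hv : IsTame v) {s : ℝ} (hs : 0 < s) : IntegrableOn (v s) (Ioo 0 Real.pi) :=
  memLp_one_iff_integrable.1 (hv.memLp hs 1)

theorem integrableOn_prod (hv : IsTame v) {T : ℝ} (hT : 0 < T) :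
    IntegrableOn (fun z : ℝ × ℝ => v z.1 z.2) (Ioo 0 T ×ˢ Ioo 0 Real.pi) := by
  obtain ⟨C, hC⟩ := hv.bound T hT
  have h1 : Integrable (fun z : ℝ × ℝ => (C * z.1 ^ (-(3 / 4) : ℝ)) * 1)
      ((volume.restrict (Ioo 0 T)).prod (volume.restrict (Ioo 0 Real.pi))) :=
    ((integrableOn_rpow_Ioo (by norm_num) hT).const_mul C).mul_prod (integrable_const 1)
  rw [Measure.prod_restrict] at h1
  refine Integrable.mono' h1 hv.measurable.aestronglyMeasurable ?_
  filter_upwards [ae_restrict_mem (measurableSet_Ioo.prod measurableSet_Ioo)] with z hz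
  rw [mul_one]
  exact hC z.1 hz.1.1 hz.1.2.le z.2

theorem measurable_cosCoeff (hv : IsTame v) (k : ℕ) : Measurable fun s => cosCoeff (v s) k := by
  have : Measurable (Function.uncurry fun s x => v s x * cosBasis k x) :=
    hv.measurable.mul ((continuous_cosBasis k).measurable.comp measurable_snd)
  exact this.stronglyMeasurable.integral_prod_right.measurable

theorem integrableOn_cosCoeff (hv : IsTame v) (k : ℕ) {t : ℝ} (ht : 0 < t) :
    IntegrableOn (fun s => cosCoeff (v s) k) (Ioo 0 t) := by
  obtain ⟨C, hC⟩ := hv.bound t ht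
  refine Integrable.mono' (((integrableOn_rpow_Ioo (a := -(3 / 4)) (by norm_num) ht).const_mul C).mul_const
    Real.pi) (hv.measurable_cosCoeff k).aestronglyMeasurable ?_
  filter_upwards [ae_restrict_mem measurableSet_Ioo] with s hs
  exact abs_cosCoeff_le (fun x => hC s hs.1 hs.2.le x) k

theorem integrableOn_duhamel (hv : IsTame v) (k : ℕ) {t : ℝ} (ht : 0 < t) :
    IntegrableOn (fun s => Real.exp (-((k : ℝ) ^ 2 * (t - s))) * cosCoeff (v s) k) (Ioo 0 t) := by
  refine Integrable.bdd_mul (c := 1) (hv.integrableOn_cosCoeff k ht)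
    (by fun_prop) ?_
  filter_upwards [ae_restrict_mem measurableSet_Ioo] with s hs
  rw [Real.norm_eq_abs, Real.abs_exp, Real.exp_le_one_iff]
  have : 0 ≤ t - s := by linarith [hs.2]
  have := mul_nonneg (sq_nonneg (k : ℝ)) this
  linarith

theorem measurable_duhamelCoeff (hv : IsTame v) (k : ℕ) : Measurable (duhamelCoeff v k) := by
  -- The domain of integration depends on `t`; an indicator moves this dependence into the
  -- integrand, where joint measurability applies.
  have e : duhamelCoeff v k = fun t => ∫ s, (Ioi (0 : ℝ) ×ˢ univ ∩ {z : ℝ × ℝ | z.1 < z.2}).indicator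
      (fun z => Real.exp (-((k : ℝ) ^ 2 * (z.2 - z.1))) * cosCoeff (v z.1) k) (s, t) := by
    ext t
    rw [duhamelCoeff, ← integral_indicator measurableSet_Ioo]
    congr 1
    ext s
    simp [indicator, mem_Ioo]
  have hm : Measurable ((Ioi (0 : ℝ) ×ˢ univ ∩ {z : ℝ × ℝ | z.1 < z.2}).indicator
      (fun z => Real.exp (-((k : ℝ) ^ 2 * (z.2 - z.1))) * cosCoeff (v z.1) k)) := by
    refine Measurable.indicator ?_ ((measurableSet_Ioi.prod MeasurableSet.univ).inter
      (measurableSet_lt measurable_fst measurable_snd))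
    exact (by fun_prop : Measurable fun z : ℝ × ℝ => Real.exp (-((k : ℝ) ^ 2 * (z.2 - z.1)))).mul
      ((hv.measurable_cosCoeff k).comp measurable_fst)
  rw [e]
  exact hm.stronglyMeasurable.integral_prod_left'.measurable

end IsTame

/-! ### Minkowski in time and the creation operator bound -/

/-- The integral of a function against a finite cosine sum. -/
theorem sum_mul_cosCoeff {f : ℝ → ℝ} (hf : IntegrableOn f (Ioo 0 Real.pi)) (c : ℕ → ℝ)
    (N : ℕ) :
    ∑ k ∈ Finset.range N, c k * cosCoeff f k
      = ∫ x in Ioo 0 Real.pi, (∑ k ∈ Finset.range N, c k * cosBasis k x) * f x := by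
  simp only [Finset.sum_mul, cosCoeff]
  rw [integral_finsetSum]
  · refine Finset.sum_congr rfl fun k _ => ?_
    rw [← integral_const_mul]
    congr 1
    ext x
    ring
  · intro k _
    refine ((integrableOn_mul_cosBasis hf k).const_mul (c k)).congr (ae_of_all _ fun x => ?_)
    simp only
    ring

/-- Minkowski's integral inequality for a finite family of real functions. -/
theorem sum_sq_integral_le {ι : Type*} {X : Type*} [MeasurableSpace X] {μ : Measure X}
    (S : Finset ι) (G : ι → X → ℝ) (hG : ∀ i ∈ S, Integrable (G i) μ) (H : X → ℝ)
    (hH : Integrable H μ) (hH0 : ∀ᵐ s ∂μ, 0 ≤ H s)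
    (h : ∀ᵐ s ∂μ, ∑ i ∈ S, G i s ^ 2 ≤ H s ^ 2) :
    ∑ i ∈ S, (∫ s, G i s ∂μ) ^ 2 ≤ (∫ s, H s ∂μ) ^ 2 := by
  set v : ι → ℝ := fun i => ∫ s, G i s ∂μ with hv
  set V := √(∑ i ∈ S, v i ^ 2) with hV
  have hV2 : V ^ 2 = ∑ i ∈ S, v i ^ 2 := Real.sq_sqrt (Finset.sum_nonneg fun i _ => sq_nonneg _)
  have hV0 : 0 ≤ V := Real.sqrt_nonneg _
  have hI : 0 ≤ ∫ s, H s ∂μ := integral_nonneg_of_ae hH0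
  -- Duality: the vector of integrals is paired with itself, Cauchy–Schwarz is applied under the
  -- integral, and one factor `V` is then divided out.
  have key : V ^ 2 ≤ V * ∫ s, H s ∂μ := by
    calc V ^ 2 = ∫ s, ∑ i ∈ S, v i * G i s ∂μ := by
          rw [hV2, integral_finsetSum _ fun i hi => (hG i hi).const_mul _]
          refine Finset.sum_congr rfl fun i _ => ?_
          rw [integral_const_mul, sq]
      _ ≤ ∫ s, V * H s ∂μ := by
          refine integral_mono_ae (integrable_finsetSum _ fun i hi => (hG i hi).const_mul _)
            (hH.const_mul V) ?_
          filter_upwards [hH0, h] with s h0 hs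
          refine abs_le_of_sq_le_sq' ?_ (mul_nonneg hV0 h0) |>.2
          rw [mul_pow, hV2]
          exact (Finset.sum_mul_sq_le_sq_mul_sq S v fun i => G i s).trans
            (mul_le_mul_of_nonneg_left hs (Finset.sum_nonneg fun i _ => sq_nonneg _))
      _ = _ := integral_const_mul _ _
  rw [← hV2]
  rcases hV0.eq_or_lt with h0 | h0
  · rw [← h0, zero_pow two_ne_zero]
    positivity
  · exact pow_le_pow_left₀ hV0 (by nlinarith) 2

/-- A bound in space at each time, for a family of sources tested against a truncated heat kernel,
gives a bound for the corresponding mild solutions. -/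
theorem sum_sq_duhamel_le {ι : Type*} (S : Finset ι) (F : ι → ℝ → ℝ → ℝ)
    (hF : ∀ i ∈ S, IsTame (F i)) (c : ℕ → ℝ) (N : ℕ) {t : ℝ} (ht : 0 < t) (H : ℝ → ℝ)
    (hH : IntegrableOn H (Ioo 0 t)) (hH0 : ∀ s ∈ Ioo 0 t, 0 ≤ H s)
    (h : ∀ s ∈ Ioo 0 t, ∑ i ∈ S, (∫ x in Ioo 0 Real.pi,
      (∑ k ∈ Finset.range N, (c k * Real.exp (-((k : ℝ) ^ 2 * (t - s)))) * cosBasis k x)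
        * F i s x) ^ 2 ≤ H s ^ 2) :
    ∑ i ∈ S, (∑ k ∈ Finset.range N, c k * duhamelCoeff (F i) k t) ^ 2
      ≤ (∫ s in Ioo 0 t, H s) ^ 2 := by
  set G : ι → ℝ → ℝ := fun i s => ∑ k ∈ Finset.range N,
    c k * (Real.exp (-((k : ℝ) ^ 2 * (t - s))) * cosCoeff (F i s) k) with hG
  have e : ∀ i ∈ S, ∑ k ∈ Finset.range N, c k * duhamelCoeff (F i) k t = ∫ s in Ioo 0 t, G i s :=
    fun i hi => by
      simp only [hG]
      rw [integral_finsetSum _ fun k _ => ((hF i hi).integrableOn_duhamel k ht).const_mul _]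
      simp only [integral_const_mul, duhamelCoeff]
  rw [Finset.sum_congr rfl fun i hi => by rw [e i hi]]
  refine sum_sq_integral_le S G (fun i hi => integrable_finsetSum _ fun k _ =>
    ((hF i hi).integrableOn_duhamel k ht).const_mul _) H hH ?_ ?_
  · filter_upwards [ae_restrict_mem measurableSet_Ioo] with s hs using hH0 s hs
  · filter_upwards [ae_restrict_mem measurableSet_Ioo] with s hs
    refine (Finset.sum_le_sum fun i hi => le_of_eq ?_).trans (h s hs)
    rw [← sum_mul_cosCoeff ((hF i hi).integrableOn hs.1)]
    simp only [hG, mul_assoc]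

theorem continuous_sum_cosBasis (c : ℕ → ℝ) (N : ℕ) :
    Continuous fun x => ∑ k ∈ Finset.range N, c k * cosBasis k x :=
  continuous_finsetSum _ fun k _ => continuous_const.mul (continuous_cosBasis k)

theorem memLp_continuous_mul {f : ℝ → ℝ} {A : ℝ} (hfm : Measurable f) (hf : ∀ x, |f x| ≤ A)
    {K : ℝ → ℝ} (hK : Continuous K) : MemLp (fun x => K x * f x) 2 intervalMeasure := by
  have hK2 : IntegrableOn (fun x => K x ^ 2) (Ioo 0 Real.pi) :=
    (hK.pow 2).integrableOn_Icc.mono_set Ioo_subset_Icc_self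
  refine (memLp_two_iff_integrable_sq ?_).2 ?_
  · exact (hK.measurable.mul hfm).aestronglyMeasurable
  · refine Integrable.mono' (hK2.mul_const (A ^ 2))
      ((hK.measurable.mul hfm).pow_const 2).aestronglyMeasurable (ae_of_all _ fun x => ?_)
    rw [mul_pow, Real.norm_eq_abs, abs_of_nonneg (by positivity)]
    exact mul_le_mul_of_nonneg_left (sq_le_sq' (abs_le.1 (hf x)).1 (abs_le.1 (hf x)).2)
      (sq_nonneg _)

/-- Cauchy–Schwarz against a bounded function, read off from Bessel's inequality with the single
constant mode `1 / √π`. -/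
theorem sq_integral_mul_le {f : ℝ → ℝ} {A : ℝ} (hfm : Measurable f) (hf : ∀ x, |f x| ≤ A)
    {K : ℝ → ℝ} (hK : Continuous K) :
    (∫ x in Ioo 0 Real.pi, K x * f x) ^ 2
      ≤ Real.pi * A ^ 2 * ∫ x in Ioo 0 Real.pi, K x ^ 2 := by
  have hK2 : IntegrableOn (fun x => K x ^ 2) (Ioo 0 Real.pi) :=
    (hK.pow 2).integrableOn_Icc.mono_set Ioo_subset_Icc_self
  have hKf := memLp_continuous_mul hfm hf hK
  have hb := sum_sq_integral_mul_cosBasis_le _ hKf {0}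
  have e : ∫ x in Ioo 0 Real.pi, K x * f x * cosBasis 0 x
      = (1 / √Real.pi) * ∫ x in Ioo 0 Real.pi, K x * f x := by
    rw [← integral_const_mul]
    congr 1
    ext x
    simp [cosBasis]
    ring
  rw [Finset.sum_singleton, e, mul_pow, div_pow, Real.sq_sqrt Real.pi_pos.le, one_pow,
    one_div_mul_eq_div, div_le_iff₀ Real.pi_pos] at hb
  refine hb.trans ?_
  have : ∫ x in Ioo 0 Real.pi, (K x * f x) ^ 2 ≤ ∫ x in Ioo 0 Real.pi, K x ^ 2 * A ^ 2 := by
    refine integral_mono hKf.integrable_sq (hK2.mul_const _) fun x => ?_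
    simp only [mul_pow]
    exact mul_le_mul_of_nonneg_left (sq_le_sq' (abs_le.1 (hf x)).1 (abs_le.1 (hf x)).2)
      (sq_nonneg _)
  rw [integral_mul_const] at this
  nlinarith [Real.pi_pos]

theorem MultiIdx.degree_sub_single {α : MultiIdx} {n k : ℕ} (hα : α.degree = n + 1)
    (hk : k ∈ α.support) : (α - Finsupp.single k 1).degree = n := by
  have hle : Finsupp.single k 1 ≤ α := by
    rw [Finsupp.single_le_iff]
    exact Nat.one_le_iff_ne_zero.2 (Finsupp.mem_support_iff.1 hk)
  have h := congrArg Finsupp.degree (tsub_add_cancel_of_le hle)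
  rw [map_add, Finsupp.degree_single, hα] at h
  omega

/-- The `L²` bound for the creation operator: testing the sources of degree `n + 1` against a
function `K` costs a factor `n + 1`. -/
theorem sum_sq_integral_mul_chaosSource_le (u : MultiIdx → ℝ → ℝ → ℝ) {n : ℕ}
    (hu : ∀ β : MultiIdx, β.degree = n → IsTame (u β)) {s : ℝ} (hs : 0 < s) {A : ℝ}
    (hA : ∀ S : Finset MultiIdx, (∀ β ∈ S, β.degree = n) → ∀ x, ∑ β ∈ S, u β s x ^ 2 ≤ A ^ 2)
    (S : Finset MultiIdx) (hS : ∀ α ∈ S, α.degree = n + 1) {K : ℝ → ℝ} (hK : Continuous K) :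
    ∑ α ∈ S, (∫ x in Ioo 0 Real.pi, K x * chaosSource u α s x) ^ 2
      ≤ (n + 1) * (A ^ 2 * ∫ x in Ioo 0 Real.pi, K x ^ 2) := by
  have hK2 : IntegrableOn (fun x => K x ^ 2) (Ioo 0 Real.pi) :=
    (hK.pow 2).integrableOn_Icc.mono_set Ioo_subset_Icc_self
  have hKu : ∀ β : MultiIdx, β.degree = n → MemLp (fun x => K x * u β s x) 2 intervalMeasure := by
    intro β hβ
    obtain ⟨C, hC⟩ := (hu β hβ).bound s hs
    exact memLp_continuous_mul ((hu β hβ).measurable_right s) (hC s hs le_rfl) hK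
  set J : ℕ → MultiIdx → ℝ := fun j β =>
    ∫ x in Ioo 0 Real.pi, K x * u β s x * cosBasis j x with hJ
  have hsub : ∀ α ∈ S, ∀ j ∈ α.support, (α - Finsupp.single j 1).degree = n := fun α hα j hj =>
    MultiIdx.degree_sub_single (hS α hα) hj
  -- Cauchy–Schwarz over the modes with weights `√α_j`: the squared weights sum to the degree, which
  -- is the factor `n + 1`.
  have h1 : ∀ α ∈ S, (∫ x in Ioo 0 Real.pi, K x * chaosSource u α s x) ^ 2
      ≤ (n + 1) * ∑ j ∈ α.support, J j (α - Finsupp.single j 1) ^ 2 := by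
    intro α hα
    have e : ∫ x in Ioo 0 Real.pi, K x * chaosSource u α s x
        = ∑ j ∈ α.support, √(α j : ℝ) * J j (α - Finsupp.single j 1) := by
      have e1 : ∀ x, K x * chaosSource u α s x = ∑ j ∈ α.support, √(α j : ℝ)
          * (K x * u (α - Finsupp.single j 1) s x * cosBasis j x) := fun x => by
        rw [chaosSource, Finset.mul_sum]
        exact Finset.sum_congr rfl fun j _ => by ring
      rw [integral_congr_ae (ae_of_all _ e1), integral_finsetSum]
      · simp only [integral_const_mul, hJ]
      · intro j hj
        exact (integrableOn_mul_cosBasis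
          ((hKu _ (hsub α hα j hj)).integrable one_le_two) j).const_mul _
    rw [e]
    refine (Finset.sum_mul_sq_le_sq_mul_sq _ _ _).trans (le_of_eq ?_)
    congr 1
    have := hS α hα
    simp only [Real.sq_sqrt (Nat.cast_nonneg _)]
    rw [← Nat.cast_sum, ← Finsupp.degree_apply, this]
    push_cast
    ring
  refine (Finset.sum_le_sum h1).trans ?_
  rw [← Finset.mul_sum]
  refine mul_le_mul_of_nonneg_left ?_ (by positivity)
  set L : Finset ℕ := S.biUnion fun α => α.support with hL
  set S' : Finset MultiIdx :=
    S.biUnion fun α => α.support.image fun j => α - Finsupp.single j 1 with hS'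
  have hS'deg : ∀ β ∈ S', β.degree = n := by
    intro β hβ
    rw [hS', Finset.mem_biUnion] at hβ
    obtain ⟨α, hα, hβ⟩ := hβ
    obtain ⟨j, hj, rfl⟩ := Finset.mem_image.1 hβ
    exact hsub α hα j hj
  -- The map `(α, j) ↦ (α - ε(j), j)` is injective on pairs with `j` in the support, so the double
  -- sum is at most a sum over independent `β` and `j`. For fixed `β` the sum over `j` is a Bessel
  -- sum for `K u_β`.
  calc ∑ α ∈ S, ∑ j ∈ α.support, J j (α - Finsupp.single j 1) ^ 2
      = ∑ p ∈ S.sigma fun α => α.support, J p.2 (p.1 - Finsupp.single p.2 1) ^ 2 :=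
        Finset.sum_sigma' _ _ _
    _ = ∑ q ∈ (S.sigma fun α => α.support).image
          (fun p : (_ : MultiIdx) × ℕ => (p.1 - Finsupp.single p.2 1, p.2)), J q.2 q.1 ^ 2 := by
        rw [Finset.sum_image]
        rintro ⟨α, j⟩ hp ⟨β, i⟩ hq h
        simp only [Prod.mk.injEq] at h
        obtain ⟨h, rfl⟩ := h
        have hle : ∀ γ : MultiIdx, j ∈ γ.support → Finsupp.single j 1 ≤ γ := fun γ hγ => by
          rw [Finsupp.single_le_iff]
          exact Nat.one_le_iff_ne_zero.2 (Finsupp.mem_support_iff.1 hγ)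
        have hα := hle α (Finset.mem_sigma.1 hp).2
        have hβ := hle β (Finset.mem_sigma.1 hq).2
        have : α = β := by rw [← tsub_add_cancel_of_le hα, h, tsub_add_cancel_of_le hβ]
        rw [this]
    _ ≤ ∑ q ∈ S' ×ˢ L, J q.2 q.1 ^ 2 := by
        refine Finset.sum_le_sum_of_subset_of_nonneg ?_ fun _ _ _ => sq_nonneg _
        intro q hq
        obtain ⟨⟨α, j⟩, hp, rfl⟩ := Finset.mem_image.1 hq
        have hp := Finset.mem_sigma.1 hp
        exact Finset.mem_product.2 ⟨Finset.mem_biUnion.2 ⟨α, hp.1, Finset.mem_image_of_mem _ hp.2⟩,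
          Finset.mem_biUnion.2 ⟨α, hp.1, hp.2⟩⟩
    _ = ∑ β ∈ S', ∑ j ∈ L, J j β ^ 2 := Finset.sum_product _ _ _
    _ ≤ ∑ β ∈ S', ∫ x in Ioo 0 Real.pi, (K x * u β s x) ^ 2 :=
        Finset.sum_le_sum fun β hβ =>
          sum_sq_integral_mul_cosBasis_le _ (hKu β (hS'deg β hβ)) L
    _ = ∫ x in Ioo 0 Real.pi, ∑ β ∈ S', (K x * u β s x) ^ 2 :=
        (integral_finsetSum _ fun β hβ => (hKu β (hS'deg β hβ)).integrable_sq).symm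
    _ ≤ ∫ x in Ioo 0 Real.pi, A ^ 2 * K x ^ 2 := by
        refine integral_mono
          (integrable_finsetSum _ fun β hβ => (hKu β (hS'deg β hβ)).integrable_sq)
          (hK2.const_mul _) fun x => ?_
        simp only [mul_pow, ← Finset.mul_sum]
        rw [mul_comm]
        exact mul_le_mul_of_nonneg_right (hA S' hS'deg x) (sq_nonneg _)
    _ = _ := integral_const_mul _ _

/-! ### Heat kernel norms and Beta-type integrals -/

/-- `y ^ θ` is at most `1` or `y²` according to the side of `1`, and both are below `2 exp y`. -/
theorem exp_neg_le_two_mul_rpow {y θ : ℝ} (hy : 0 < y) (h0 : 0 ≤ θ) (h2 : θ ≤ 2) :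
    Real.exp (-y) ≤ 2 * y ^ (-θ) := by
  have hpos : 0 < y ^ θ := Real.rpow_pos_of_pos hy θ
  have h : y ^ θ ≤ 2 * Real.exp y := by
    have hq := Real.quadratic_le_exp_of_nonneg hy.le
    rcases le_total y 1 with h1 | h1
    · have := Real.rpow_le_one hy.le h1 h0
      nlinarith [sq_nonneg y]
    · have := Real.rpow_le_rpow_of_exponent_le h1 h2
      rw [Real.rpow_two] at this
      nlinarith
  rw [Real.exp_neg, Real.rpow_neg hy.le, ← div_eq_mul_inv, inv_eq_one_div,
    div_le_div_iff₀ (Real.exp_pos y) hpos]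
  linarith

/-- Bounds for the heat trace and its first moment. -/
theorem exists_sum_exp_le (m : ℕ) (hm : m ≤ 1) {T : ℝ} (hT : 0 < T) :
    ∃ C : ℝ, 0 ≤ C ∧ ∀ r, 0 < r → r ≤ T → ∀ N : ℕ,
      ∑ k ∈ Finset.range N, Real.exp (-((k : ℝ) ^ 2 * r)) * ((1 + k : ℝ) ^ m) ^ 2
        ≤ C * r ^ (-(m + 3 / 4) : ℝ) := by
  have hm' : (m : ℝ) ≤ 1 := by exact_mod_cast hm
  -- Any exponent above `m + 1/2` would make the sum converge; this one leaves the terms `k ^ (2m -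
  -- 2θ) = k ^ (-3/2)`. The mode `k = 0` does not decay and is absorbed by `T ^ θ`, using `r ≤ T`.
  set θ : ℝ := m + 3 / 4 with hθ
  have hθ0 : 0 ≤ θ := by positivity
  have hθ2 : θ ≤ 2 := by linarith
  set a : ℕ → ℝ := fun k => (if k = 0 then T ^ θ else 0) + 2 * 4 ^ m * (k : ℝ) ^ (-(3 / 2) : ℝ)
    with ha
  have ha0 : ∀ k, 0 ≤ a k := fun k => by
    have : 0 ≤ T ^ θ := Real.rpow_nonneg hT.le _
    simp only [ha]
    split_ifs <;> positivity
  have hsum : Summable a := by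
    refine Summable.add ?_ ((Real.summable_nat_rpow.2 (by norm_num)).mul_left _)
    exact summable_of_ne_finset_zero (s := {0}) fun k hk => if_neg (by simpa using hk)
  refine ⟨∑' k, a k, tsum_nonneg ha0, fun r hr hrT N => ?_⟩
  have hrθ : 0 < r ^ (-θ) := Real.rpow_pos_of_pos hr _
  calc ∑ k ∈ Finset.range N, Real.exp (-((k : ℝ) ^ 2 * r)) * ((1 + k : ℝ) ^ m) ^ 2
      ≤ ∑ k ∈ Finset.range N, a k * r ^ (-θ) := by
        refine Finset.sum_le_sum fun k _ => ?_
        rcases Nat.eq_zero_or_pos k with rfl | hk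
        · have h1 : 1 ≤ T ^ θ * r ^ (-θ) := by
            rw [Real.rpow_neg hr.le, ← div_eq_mul_inv, one_le_div (Real.rpow_pos_of_pos hr _)]
            exact Real.rpow_le_rpow hr.le hrT hθ0
          -- By convention `0` to a nonzero real power is `0`, so the tail part of `a` does not
          -- contribute at `k = 0`.
          have h2 : ((0 : ℕ) : ℝ) ^ (-(3 / 2) : ℝ) = 0 := by
            rw [Nat.cast_zero, Real.zero_rpow (by norm_num)]
          simp only [ha, h2]
          simpa using h1
        · have hk' : (0 : ℝ) < k := by exact_mod_cast hk
          have hk1 : (1 : ℝ) ≤ k := by exact_mod_cast hk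
          have h1 := exp_neg_le_two_mul_rpow (y := (k : ℝ) ^ 2 * r) (by positivity) hθ0 hθ2
          -- The constant `4 ^ m` comes from `(1 + k)² ≤ 4 k²` for `k ≥ 1`.
          have h2 : ((1 + k : ℝ) ^ m) ^ 2 ≤ 4 ^ m * (k : ℝ) ^ (2 * m) := by
            rw [← pow_mul, mul_comm m 2, pow_mul, pow_mul, ← mul_pow]
            exact pow_le_pow_left₀ (by positivity) (by nlinarith) m
          have h3 : ((k : ℝ) ^ 2) ^ (-θ) * (k : ℝ) ^ (2 * m) = (k : ℝ) ^ (-(3 / 2) : ℝ) := by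
            rw [← Real.rpow_natCast _ (2 * m), ← Real.rpow_natCast _ 2, ← Real.rpow_mul hk'.le,
              ← Real.rpow_add hk', hθ]
            congr 1
            push_cast
            ring
          have h4 : a k = 2 * 4 ^ m * (((k : ℝ) ^ 2) ^ (-θ) * (k : ℝ) ^ (2 * m)) := by
            rw [h3]
            simp [ha, hk.ne']
          calc Real.exp (-((k : ℝ) ^ 2 * r)) * ((1 + k : ℝ) ^ m) ^ 2
              ≤ (2 * ((k : ℝ) ^ 2 * r) ^ (-θ)) * (4 ^ m * (k : ℝ) ^ (2 * m)) :=
                mul_le_mul h1 h2 (by positivity) (by positivity)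
            _ = a k * r ^ (-θ) := by
                rw [h4, Real.mul_rpow (by positivity) hr.le]
                ring
    _ = (∑ k ∈ Finset.range N, a k) * r ^ (-θ) := (Finset.sum_mul _ _ _).symm
    _ ≤ _ := mul_le_mul_of_nonneg_right (hsum.sum_le_tsum _ fun k _ => ha0 k) hrθ.le

/-- The `L²` norm of the truncated heat kernel (`m = 0`) and of its derivative (`m = 1`). -/
theorem exists_integral_kernel_sq_le (m : ℕ) (hm : m ≤ 1) {T : ℝ} (hT : 0 < T) :
    ∃ C : ℝ, 0 ≤ C ∧ ∀ c : ℕ → ℝ, (∀ k, |c k| ≤ (1 + k : ℝ) ^ m) → ∀ r, 0 < r → r ≤ T → ∀ N : ℕ,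
      ∫ x in Ioo 0 Real.pi, (∑ k ∈ Finset.range N,
        (c k * Real.exp (-((k : ℝ) ^ 2 * r))) * cosBasis k x) ^ 2
        ≤ (C * r ^ (-(m / 2 + 3 / 8) : ℝ)) ^ 2 := by
  obtain ⟨C, hC0, hC⟩ := exists_sum_exp_le m hm hT
  refine ⟨√C, Real.sqrt_nonneg _, fun c hc r hr hrT N => ?_⟩
  -- Orthonormality turns the norm into a heat trace; the exponent `m/2 + 3/8` is half of `m + 3/4`.
  rw [integral_sum_cosBasis_sq, mul_pow, Real.sq_sqrt hC0, ← Real.rpow_mul_natCast hr.le]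
  refine le_trans (Finset.sum_le_sum fun k _ => ?_) ((hC r hr hrT N).trans (le_of_eq ?_))
  · rw [mul_pow, mul_comm]
    refine mul_le_mul ?_ ?_ (sq_nonneg _) (Real.exp_pos _).le
    · rw [sq]
      refine mul_le_of_le_one_left (Real.exp_pos _).le (Real.exp_le_one_iff.2 ?_)
      have := mul_nonneg (sq_nonneg (k : ℝ)) hr.le
      linarith
    · rw [← sq_abs]
      exact pow_le_pow_left₀ (abs_nonneg _) (hc k) 2
  · congr 2
    push_cast
    ring

theorem integrableOn_sub_rpow {a : ℝ} (ha : a < 1) {t : ℝ} (ht : 0 < t) :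
    IntegrableOn (fun s : ℝ => (t - s) ^ (-a)) (Ioo 0 t) := by
  have h := (intervalIntegral.intervalIntegrable_rpow' (a := 0) (b := t) (r := -a)
    (by linarith)).comp_sub_left t
  rw [sub_zero, sub_self] at h
  exact ((intervalIntegrable_iff_integrableOn_Ioo_of_le ht.le).1 h.symm)

theorem integral_rpow_Ioo {a : ℝ} (ha : a < 1) {t : ℝ} (ht : 0 < t) :
    ∫ s in Ioo 0 t, s ^ (-a) = t ^ (1 - a) / (1 - a) := by
  rw [setIntegral_Ioo_eq_intervalIntegral ht.le, integral_rpow (Or.inl (by linarith)),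
    Real.zero_rpow (by linarith)]
  ring_nf

theorem integral_sub_rpow_Ioo {a : ℝ} (ha : a < 1) {t : ℝ} (ht : 0 < t) :
    ∫ s in Ioo 0 t, (t - s) ^ (-a) = t ^ (1 - a) / (1 - a) := by
  rw [← integral_rpow_Ioo ha ht, setIntegral_Ioo_eq_intervalIntegral ht.le,
    setIntegral_Ioo_eq_intervalIntegral ht.le,
    intervalIntegral.integral_comp_sub_left (fun s => s ^ (-a)) t]
  simp

/-- A bound for the Beta-type integral `∫₀ᵗ (t - s)⁻ᵃ s⁻ᵇ ds`. -/
theorem exists_integral_rpow_mul_rpow_le {a b : ℝ} (ha0 : 0 ≤ a) (ha : a < 1) (hb0 : 0 ≤ b)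
    (hb : b < 1) : ∃ C : ℝ, 0 ≤ C ∧ ∀ t : ℝ, 0 < t →
      IntegrableOn (fun s => (t - s) ^ (-a) * s ^ (-b)) (Ioo 0 t) ∧
      ∫ s in Ioo 0 t, (t - s) ^ (-a) * s ^ (-b) ≤ C * t ^ (1 - a - b) := by
  have ha1 : 0 < 1 - a := by linarith
  have hb1 : 0 < 1 - b := by linarith
  refine ⟨2 ^ a / (1 - b) + 2 ^ b / (1 - a), by positivity, fun t ht => ?_⟩
  have hI : IntegrableOn (fun s => (t / 2) ^ (-a) * s ^ (-b) + (t / 2) ^ (-b) * (t - s) ^ (-a))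
      (Ioo 0 t) :=
    ((integrableOn_rpow_Ioo (by linarith) ht).const_mul _).add
      ((integrableOn_sub_rpow ha ht).const_mul _)
  -- On each side of `t / 2` only one factor is singular, and the other is at most its value at the
  -- midpoint.
  have hle : ∀ s ∈ Ioo 0 t, (t - s) ^ (-a) * s ^ (-b)
      ≤ (t / 2) ^ (-a) * s ^ (-b) + (t / 2) ^ (-b) * (t - s) ^ (-a) := by
    intro s hs
    have hs0 : 0 < s := hs.1
    have hts : 0 < t - s := by linarith [hs.2]
    have p1 : 0 ≤ s ^ (-b) := by positivity
    have p2 : 0 ≤ (t - s) ^ (-a) := by positivity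
    have p3 : 0 ≤ (t / 2) ^ (-a) := by positivity
    have p4 : 0 ≤ (t / 2) ^ (-b) := by positivity
    rcases le_total s (t / 2) with h | h
    · have : (t - s) ^ (-a) ≤ (t / 2) ^ (-a) :=
        Real.rpow_le_rpow_of_nonpos (by linarith) (by linarith) (by linarith)
      nlinarith [mul_le_mul_of_nonneg_right this p1, mul_nonneg p4 p2]
    · have : s ^ (-b) ≤ (t / 2) ^ (-b) :=
        Real.rpow_le_rpow_of_nonpos (by linarith) (by linarith) (by linarith)
      nlinarith [mul_le_mul_of_nonneg_right this p2, mul_nonneg p3 p1]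
  have hint : IntegrableOn (fun s => (t - s) ^ (-a) * s ^ (-b)) (Ioo 0 t) := by
    refine Integrable.mono' hI (by fun_prop) ?_
    filter_upwards [ae_restrict_mem measurableSet_Ioo] with s hs
    have hs0 : 0 < s := hs.1
    have hts : 0 < t - s := by linarith [hs.2]
    rw [Real.norm_eq_abs, abs_of_nonneg (by positivity)]
    exact hle s hs
  refine ⟨hint, (setIntegral_mono_on hint hI measurableSet_Ioo hle).trans (le_of_eq ?_)⟩
  rw [integral_add ((integrableOn_rpow_Ioo (by linarith) ht).const_mul _)
      ((integrableOn_sub_rpow ha ht).const_mul _), integral_const_mul, integral_const_mul,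
    integral_rpow_Ioo hb ht, integral_sub_rpow_Ioo ha ht, Real.div_rpow ht.le two_pos.le,
    Real.div_rpow ht.le two_pos.le, Real.rpow_neg two_pos.le, Real.rpow_neg two_pos.le]
  have e1 : t ^ (1 - a - b) = t ^ (-a) * t ^ (1 - b) := by
    rw [← Real.rpow_add ht]
    ring_nf
  have e2 : t ^ (1 - a - b) = t ^ (-b) * t ^ (1 - a) := by
    rw [← Real.rpow_add ht]
    ring_nf
  rw [add_mul]
  nth_rewrite 1 [e1]
  rw [e2]
  field_simp

/-! ### Differentiable cosine series and the regularity of Duhamel terms -/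

/-- The derivative of the cosine basis. -/
noncomputable def cosBasisDeriv (k : ℕ) (x : ℝ) : ℝ := -(k * (cosBasis k 0 * Real.sin (k * x)))

theorem hasDerivAt_cosBasis (k : ℕ) (x : ℝ) : HasDerivAt (cosBasis k) (cosBasisDeriv k x) x := by
  have h := (((hasDerivAt_id x).const_mul (k : ℝ)).cos).const_mul (cosBasis k 0)
  rw [funext (cosBasis_eq k)]
  refine h.congr_deriv ?_
  simp [cosBasisDeriv]
  ring

theorem abs_cosBasisDeriv_le (k : ℕ) (x : ℝ) : |cosBasisDeriv k x| ≤ k := by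
  rw [cosBasisDeriv, abs_neg, abs_mul, Nat.abs_cast, abs_mul, abs_of_pos (cosBasis_zero_pos k)]
  exact mul_le_of_le_one_right (Nat.cast_nonneg k)
    (mul_le_one₀ (cosBasis_zero_le_one k) (abs_nonneg _) (Real.abs_sin_le_one _))

section CosSeries

variable {a : ℕ → ℝ}

/-- Cruder than necessary: the majorant `(1 + k) |a k|` is shared with the differentiated series, so
that one summability hypothesis serves both. -/
theorem abs_mul_cosBasis_le (a : ℕ → ℝ) (k : ℕ) (x : ℝ) :
    |a k * cosBasis k x| ≤ (1 + k : ℝ) * |a k| := by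
  rw [abs_mul]
  have := abs_cosBasis_le_one k x
  have h2 : (0 : ℝ) ≤ k := Nat.cast_nonneg k
  nlinarith [abs_nonneg (a k)]

theorem summable_mul_cosBasis (ha : Summable fun k : ℕ => (1 + k : ℝ) * |a k|) (x : ℝ) :
    Summable fun k => a k * cosBasis k x :=
  Summable.of_norm_bounded ha fun k => abs_mul_cosBasis_le a k x

theorem continuous_cosSeries (ha : Summable fun k : ℕ => (1 + k : ℝ) * |a k|) :
    Continuous (cosSeries a) :=
  continuous_tsum (fun k => continuous_const.mul (continuous_cosBasis k)) ha
    fun k x => abs_mul_cosBasis_le a k x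

theorem abs_cosSeries_le (ha : Summable fun k : ℕ => (1 + k : ℝ) * |a k|) (x : ℝ) :
    |cosSeries a x| ≤ ∑' k : ℕ, (1 + k : ℝ) * |a k| := by
  rw [← Real.norm_eq_abs, cosSeries]
  exact tsum_of_norm_bounded ha.hasSum fun k => abs_mul_cosBasis_le a k x

theorem abs_mul_cosBasisDeriv_le (a : ℕ → ℝ) (k : ℕ) (x : ℝ) :
    |a k * cosBasisDeriv k x| ≤ (1 + k : ℝ) * |a k| := by
  rw [abs_mul]
  have := abs_cosBasisDeriv_le k x
  nlinarith [abs_nonneg (a k)]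

theorem summable_mul_cosBasisDeriv (ha : Summable fun k : ℕ => (1 + k : ℝ) * |a k|) (x : ℝ) :
    Summable fun k => a k * cosBasisDeriv k x :=
  Summable.of_norm_bounded ha fun k => abs_mul_cosBasisDeriv_le a k x

theorem hasDerivAt_cosSeries (ha : Summable fun k : ℕ => (1 + k : ℝ) * |a k|) (x : ℝ) :
    HasDerivAt (cosSeries a) (∑' k, a k * cosBasisDeriv k x) x :=
  hasDerivAt_tsum ha (fun k y => (hasDerivAt_cosBasis k y).const_mul (a k))
    (fun k y => abs_mul_cosBasisDeriv_le a k y) (summable_mul_cosBasis ha 0) x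

end CosSeries

namespace IsTame

variable {F : ℝ → ℝ → ℝ}

/-- With `c k = (1 + k) sign`, the weighted absolute sum is a truncated kernel tested against `F`,
and the derivative kernel bound applies. Convolving `r ^ (-7/8)` with `s ^ (-3/4)` gives `t ^ (1/8)
t ^ (-3/4)`, so the exponent of tameness is reproduced and the series may be differentiated
termwise. -/
theorem exists_sum_duhamel_le (hF : IsTame F) {T : ℝ} (hT : 0 < T) :
    ∃ C : ℝ, ∀ t, 0 < t → t ≤ T → ∀ N : ℕ,
      ∑ k ∈ Finset.range N, (1 + k : ℝ) * |duhamelCoeff F k t| ≤ C * t ^ (-(3 / 4) : ℝ) := by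
  obtain ⟨D, hD⟩ := hF.bound T hT
  have hD0 : 0 ≤ D := by
    have := (abs_nonneg _).trans (hD T hT le_rfl 0)
    exact nonneg_of_mul_nonneg_left this (Real.rpow_pos_of_pos hT _)
  obtain ⟨C₁, hC₁0, hC₁⟩ := exists_integral_kernel_sq_le 1 le_rfl hT
  obtain ⟨C₂, hC₂0, hC₂⟩ := exists_integral_rpow_mul_rpow_le (a := 7 / 8) (b := 3 / 4)
    (by norm_num) (by norm_num) (by norm_num) (by norm_num)
  refine ⟨√Real.pi * D * C₁ * (C₂ * T ^ (1 / 8 : ℝ)), fun t ht htT N => ?_⟩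
  set c : ℕ → ℝ := fun k => (1 + k : ℝ) * SignType.sign (duhamelCoeff F k t) with hc
  have hcabs : ∀ k, |c k| ≤ (1 + k : ℝ) ^ 1 := fun k => by
    have hk : (0 : ℝ) ≤ 1 + k := by positivity
    rw [hc, pow_one, abs_mul, abs_of_nonneg hk]
    refine mul_le_of_le_one_right hk ?_
    rcases SignType.sign (duhamelCoeff F k t) with _ | _ | _ <;> simp
  have e : ∀ k, c k * duhamelCoeff F k t = (1 + k : ℝ) * |duhamelCoeff F k t| := fun k => by
    rw [hc, mul_assoc, sign_mul_self]
  obtain ⟨hint, hle⟩ := hC₂ t ht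
  have hmain := sum_sq_duhamel_le (ι := Unit) {()} (fun _ => F) (fun _ _ => hF) c N ht
    (fun s => (√Real.pi * D * C₁) * ((t - s) ^ (-(7 / 8) : ℝ) * s ^ (-(3 / 4) : ℝ)))
    (hint.const_mul _) (fun s hs => by
      have h1 : 0 < s := hs.1
      have h2 : 0 < t - s := by linarith [hs.2]
      positivity) (fun s hs => by
      have h1 : 0 < s := hs.1
      have h2 : 0 < t - s := by linarith [hs.2]
      rw [Finset.sum_singleton]
      refine (sq_integral_mul_le (hF.measurable_right s) (hD s hs.1 (hs.2.le.trans htT))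
        (continuous_sum_cosBasis _ N)).trans ?_
      refine (mul_le_mul_of_nonneg_left (hC₁ c hcabs (t - s) h2 (by linarith) N)
        (by positivity)).trans (le_of_eq ?_)
      have e1 : (-(((1 : ℕ) : ℝ) / 2 + 3 / 8) : ℝ) = -(7 / 8) := by norm_num
      rw [e1]
      simp only [mul_pow, Real.sq_sqrt Real.pi_pos.le]
      ring)
  rw [Finset.sum_singleton, integral_const_mul] at hmain
  simp only [e] at hmain
  have hpos : 0 ≤ √Real.pi * D * C₁ := by positivity
  have hint0 : 0 ≤ ∫ s in Ioo 0 t, (t - s) ^ (-(7 / 8) : ℝ) * s ^ (-(3 / 4) : ℝ) :=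
    setIntegral_nonneg measurableSet_Ioo fun s hs => by
      have h1 : 0 < s := hs.1
      have h2 : 0 < t - s := by linarith [hs.2]
      positivity
  have h3 := (abs_le_of_sq_le_sq' hmain (mul_nonneg hpos hint0)).2
  refine h3.trans ?_
  rw [mul_assoc (√Real.pi * D * C₁)]
  refine mul_le_mul_of_nonneg_left (hle.trans ?_) hpos
  rw [mul_assoc]
  refine mul_le_mul_of_nonneg_left ?_ hC₂0
  have e2 : t ^ (1 - 7 / 8 - 3 / 4 : ℝ) = t ^ (1 / 8 : ℝ) * t ^ (-(3 / 4) : ℝ) := by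
    rw [← Real.rpow_add ht]
    norm_num
  rw [e2]
  exact mul_le_mul_of_nonneg_right (Real.rpow_le_rpow ht.le htT (by norm_num)) (by positivity)

theorem summable_duhamelCoeff (hF : IsTame F) {t : ℝ} (ht : 0 < t) :
    Summable fun k : ℕ => (1 + k : ℝ) * |duhamelCoeff F k t| := by
  obtain ⟨C, hC⟩ := hF.exists_sum_duhamel_le ht
  exact summable_of_sum_range_le (fun k => by positivity) (hC t ht le_rfl)

theorem cosSeries_duhamelCoeff (hF : IsTame F) :
    IsTame fun t x => cosSeries (fun k => duhamelCoeff F k t) x := by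
  refine ⟨?_, fun T hT => ?_⟩
  · exact Measurable.tsum fun k => ((hF.measurable_duhamelCoeff k).comp measurable_fst).mul
      ((continuous_cosBasis k).measurable.comp measurable_snd)
  · obtain ⟨C, hC⟩ := hF.exists_sum_duhamel_le hT
    refine ⟨C, fun t ht htT y => (abs_cosSeries_le (hF.summable_duhamelCoeff ht) y).trans ?_⟩
    exact Real.tsum_le_of_sum_range_le (fun k => by positivity) (hC t ht htT)

end IsTame

/-! ### Tameness of each level and the recursion between levels -/

section Levels

variable {u₀ : ℝ → ℝ}

theorem abs_cosCoeff_le_integral (hu : IntegrableOn u₀ (Ioo 0 Real.pi)) (k : ℕ) :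
    |cosCoeff u₀ k| ≤ ∫ x in Ioo 0 Real.pi, |u₀ x| := by
  refine (abs_integral_le_integral_abs).trans
    (integral_mono (integrableOn_mul_cosBasis hu k).abs hu.abs fun x => ?_)
  simp only [abs_mul]
  exact mul_le_of_le_one_right (abs_nonneg _) (abs_cosBasis_le_one k x)

theorem summable_exp_mul_cosCoeff (hu : IntegrableOn u₀ (Ioo 0 Real.pi)) {t : ℝ} (ht : 0 < t) :
    Summable fun k : ℕ => (1 + k : ℝ) * |Real.exp (-((k : ℝ) ^ 2 * t)) * cosCoeff u₀ k| := by
  obtain ⟨C, -, hC⟩ := exists_sum_exp_le 1 le_rfl ht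
  have h : Summable fun k : ℕ => Real.exp (-((k : ℝ) ^ 2 * t)) * ((1 + k : ℝ) ^ 1) ^ 2 :=
    summable_of_sum_range_le (fun k => by positivity) (hC t ht le_rfl)
  refine (h.mul_right (∫ x in Ioo 0 Real.pi, |u₀ x|)).of_nonneg_of_le
    (fun k => by positivity) fun k => ?_
  have hk : (0 : ℝ) ≤ k := Nat.cast_nonneg k
  rw [abs_mul, Real.abs_exp, ← mul_assoc, mul_comm (1 + k : ℝ)]
  refine mul_le_mul (mul_le_mul_of_nonneg_left ?_ (Real.exp_pos _).le)
    (abs_cosCoeff_le_integral hu k) (abs_nonneg _) (by positivity)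
  nlinarith

/-- Integrability of `u₀` bounds all its coefficients by its `L¹` norm, and the heat trace with `m =
0` supplies the exponent `-3/4`. -/
theorem isTame_chaosLevel_zero (hu : IntegrableOn u₀ (Ioo 0 Real.pi)) (α : MultiIdx) :
    IsTame (chaosLevel u₀ 0 α) := by
  refine ⟨?_, fun T hT => ?_⟩
  · refine Measurable.ite (measurableSet_lt measurable_const measurable_fst) ?_ measurable_const
    refine Measurable.tsum fun k => Measurable.mul ?_
      ((continuous_cosBasis k).measurable.comp measurable_snd)
    fun_prop
  · obtain ⟨C, -, hC⟩ := exists_sum_exp_le 0 zero_le_one hT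
    set I := ∫ x in Ioo 0 Real.pi, |u₀ x| with hI
    have hI0 : 0 ≤ I := integral_nonneg fun x => abs_nonneg _
    refine ⟨C * I, fun t ht htT y => ?_⟩
    simp only [chaosLevel, ht, if_true]
    have hs := summable_mul_cosBasis (summable_exp_mul_cosCoeff hu ht) y
    have hb : ∀ N : ℕ, ∑ k ∈ Finset.range N,
        |Real.exp (-((k : ℝ) ^ 2 * t)) * cosCoeff u₀ k * cosBasis k y|
          ≤ C * I * t ^ (-(3 / 4) : ℝ) := fun N => by
      calc _ ≤ ∑ k ∈ Finset.range N, Real.exp (-((k : ℝ) ^ 2 * t)) * ((1 + k : ℝ) ^ 0) ^ 2 * I := by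
            refine Finset.sum_le_sum fun k _ => ?_
            rw [abs_mul, abs_mul, Real.abs_exp, pow_zero, one_pow, mul_one]
            refine (mul_le_of_le_one_right (by positivity) (abs_cosBasis_le_one k y)).trans ?_
            exact mul_le_mul_of_nonneg_left (abs_cosCoeff_le_integral hu k) (Real.exp_pos _).le
        _ = (∑ k ∈ Finset.range N, Real.exp (-((k : ℝ) ^ 2 * t)) * ((1 + k : ℝ) ^ 0) ^ 2) * I :=
            (Finset.sum_mul _ _ _).symm
        _ ≤ C * t ^ (-((0 : ℕ) + 3 / 4) : ℝ) * I := mul_le_mul_of_nonneg_right (hC t ht htT N) hI0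
        _ = _ := by
            rw [Nat.cast_zero, zero_add]
            ring
    rw [← Real.norm_eq_abs]
    exact (norm_tsum_le_tsum_norm hs.norm).trans
      (Real.tsum_le_of_sum_range_le (fun k => norm_nonneg _) hb)

/-- The recursion runs over the level for an arbitrary multi-index, so no relation between `n` and
the degree of `α` is needed here. -/
theorem isTame_chaosLevel (hu : IntegrableOn u₀ (Ioo 0 Real.pi)) (n : ℕ) (α : MultiIdx) :
    IsTame (chaosLevel u₀ n α) := by
  induction n generalizing α with
  | zero => exact isTame_chaosLevel_zero hu α
  | succ n ih => exact (IsTame.chaosSource α fun k _ => ih _).cosSeries_duhamelCoeff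

theorem isTame_chaosSource (hu : IntegrableOn u₀ (Ioo 0 Real.pi)) (n : ℕ) (α : MultiIdx) :
    IsTame (chaosSource (chaosLevel u₀ n) α) :=
  IsTame.chaosSource α fun _ _ => isTame_chaosLevel hu n _

/-- One step of the recursion for the propagator, in mean square over multi-indices of a fixed
degree, for the solution (`m = 0`) and its derivative (`m = 1`). -/
theorem sum_sq_duhamel_chaosSource_le (hu : IntegrableOn u₀ (Ioo 0 Real.pi)) (n m : ℕ) {T C : ℝ}
    (hC0 : 0 ≤ C)
    (hC : ∀ c : ℕ → ℝ, (∀ k, |c k| ≤ (1 + k : ℝ) ^ m) → ∀ r, 0 < r → r ≤ T → ∀ N : ℕ,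
      ∫ x in Ioo 0 Real.pi, (∑ k ∈ Finset.range N,
        (c k * Real.exp (-((k : ℝ) ^ 2 * r))) * cosBasis k x) ^ 2
        ≤ (C * r ^ (-(m / 2 + 3 / 8) : ℝ)) ^ 2)
    {t : ℝ} (ht : 0 < t) (htT : t ≤ T) (A : ℝ → ℝ) (hA0 : ∀ s ∈ Ioo 0 t, 0 ≤ A s)
    (hA : ∀ s ∈ Ioo 0 t, ∀ S : Finset MultiIdx, (∀ β ∈ S, β.degree = n) → ∀ x,
      ∑ β ∈ S, chaosLevel u₀ n β s x ^ 2 ≤ A s ^ 2)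
    (hint : IntegrableOn (fun s => (t - s) ^ (-(m / 2 + 3 / 8) : ℝ) * A s) (Ioo 0 t))
    (S : Finset MultiIdx) (hS : ∀ α ∈ S, α.degree = n + 1) (c : ℕ → ℝ)
    (hc : ∀ k, |c k| ≤ (1 + k : ℝ) ^ m)
    (hsum : ∀ α ∈ S, Summable fun k =>
      c k * duhamelCoeff (chaosSource (chaosLevel u₀ n) α) k t) :
    ∑ α ∈ S, (∑' k, c k * duhamelCoeff (chaosSource (chaosLevel u₀ n) α) k t) ^ 2
      ≤ (√(n + 1) * C * ∫ s in Ioo 0 t, (t - s) ^ (-(m / 2 + 3 / 8) : ℝ) * A s) ^ 2 := by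
  -- All kernels are truncated at `N` with bounds independent of `N`; the limit is taken only at the
  -- end.
  have hN : ∀ N : ℕ, ∑ α ∈ S, (∑ k ∈ Finset.range N,
      c k * duhamelCoeff (chaosSource (chaosLevel u₀ n) α) k t) ^ 2
      ≤ (√(n + 1) * C * ∫ s in Ioo 0 t, (t - s) ^ (-(m / 2 + 3 / 8) : ℝ) * A s) ^ 2 := fun N => by
    rw [← integral_const_mul]
    refine sum_sq_duhamel_le S _ (fun α _ => isTame_chaosSource hu n α) c N ht _
      (hint.const_mul _) (fun s hs => ?_) fun s hs => ?_
    · have h2 : 0 < t - s := by linarith [hs.2]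
      have := hA0 s hs
      positivity
    · have h2 : 0 < t - s := by linarith [hs.2]
      refine (sum_sq_integral_mul_chaosSource_le _ (fun β _ => isTame_chaosLevel hu n β) hs.1
        (hA s hs) S hS (continuous_sum_cosBasis _ N)).trans ?_
      refine (mul_le_mul_of_nonneg_left (mul_le_mul_of_nonneg_left
        (hC c hc (t - s) h2 (by linarith [hs.1]) N) (sq_nonneg _)) (by positivity)).trans
        (le_of_eq ?_)
      simp only [mul_pow, Real.sq_sqrt (show (0 : ℝ) ≤ n + 1 by positivity)]
      ring
  exact le_of_tendsto' (tendsto_finsetSum S fun α hα =>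
    ((hsum α hα).hasSum.tendsto_sum_nat).pow 2) hN

end Levels

/-! ### Exponential weights and bounds for each degree -/

/-- The exponentially weighted Beta-type integral gains a power of the weight. -/
theorem exists_integral_rpow_mul_exp_le {a b κ : ℝ} (ha : 0 ≤ a) (hκ : 0 ≤ κ) (haκ : a + κ < 1)
    (hb0 : 0 ≤ b) (hb : b < 1) : ∃ C : ℝ, 0 ≤ C ∧ ∀ t l : ℝ, 0 < t → 0 < l →
      IntegrableOn (fun s => (t - s) ^ (-a) * (s ^ (-b) * Real.exp (l * s))) (Ioo 0 t) ∧
      ∫ s in Ioo 0 t, (t - s) ^ (-a) * (s ^ (-b) * Real.exp (l * s))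
        ≤ C * l ^ (-κ) * Real.exp (l * t) * t ^ (1 - a - κ - b) := by
  obtain ⟨C, hC0, hC⟩ := exists_integral_rpow_mul_rpow_le (a := a + κ) (b := b) (by linarith) haκ
    hb0 hb
  refine ⟨2 * C, by positivity, fun t l ht hl => ?_⟩
  obtain ⟨hi, hle⟩ := hC t ht
  have hpt : ∀ s ∈ Ioo 0 t, (t - s) ^ (-a) * (s ^ (-b) * Real.exp (l * s))
      ≤ (2 * l ^ (-κ) * Real.exp (l * t)) * ((t - s) ^ (-(a + κ)) * s ^ (-b)) := by
    intro s hs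
    have h1 : 0 < s := hs.1
    have h2 : 0 < t - s := by linarith [hs.2]
    -- The decay of `exp (-l (t - s))` is traded for `(l (t - s)) ^ (-κ)`: a gain in `l` paid for by
    -- a stronger singularity, affordable while `a + κ < 1`.
    have h3 := exp_neg_le_two_mul_rpow (y := l * (t - s)) (θ := κ) (by positivity) hκ (by linarith)
    rw [Real.mul_rpow hl.le h2.le] at h3
    have e1 : Real.exp (l * s) = Real.exp (l * t) * Real.exp (-(l * (t - s))) := by
      rw [← Real.exp_add]
      ring_nf
    have e2 : (t - s) ^ (-(a + κ)) = (t - s) ^ (-a) * (t - s) ^ (-κ) := by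
      rw [← Real.rpow_add h2]
      ring_nf
    rw [e1, e2]
    have hp : 0 ≤ (t - s) ^ (-a) * s ^ (-b) * Real.exp (l * t) := by positivity
    nlinarith [mul_le_mul_of_nonneg_left h3 hp]
  have hint : IntegrableOn (fun s => (t - s) ^ (-a) * (s ^ (-b) * Real.exp (l * s)))
      (Ioo 0 t) := by
    refine Integrable.mono' (hi.const_mul (2 * l ^ (-κ) * Real.exp (l * t))) (by fun_prop) ?_
    filter_upwards [ae_restrict_mem measurableSet_Ioo] with s hs
    have h1 : 0 < s := hs.1
    have h2 : 0 < t - s := by linarith [hs.2]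
    rw [Real.norm_eq_abs, abs_of_nonneg (by positivity)]
    exact hpt s hs
  refine ⟨hint, (setIntegral_mono_on hint (hi.const_mul _) measurableSet_Ioo hpt).trans ?_⟩
  rw [integral_const_mul]
  refine (mul_le_mul_of_nonneg_left hle (by positivity)).trans (le_of_eq ?_)
  rw [← sub_sub 1 a κ]
  ring

theorem sqrt_succ_mul_sqrt_factorial (n : ℕ) :
    √((n : ℝ) + 1) * √(n.factorial : ℝ) = √((n + 1).factorial : ℝ) := by
  rw [← Real.sqrt_mul (by positivity), Nat.factorial_succ]
  push_cast
  rfl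

section Bounds

variable {u₀ : ℝ → ℝ}

/-- Mean square bound for the chaos of order `n`, with an arbitrary exponential weight `l`. -/
theorem exists_sum_sq_chaosLevel_le (hu : IntegrableOn u₀ (Ioo 0 Real.pi)) {T : ℝ} (hT : 0 < T) :
    ∃ R M : ℝ, 0 ≤ R ∧ 0 ≤ M ∧ ∀ (n : ℕ) (l : ℝ), 1 ≤ l → ∀ t, 0 < t → t ≤ T →
      ∀ S : Finset MultiIdx, (∀ α ∈ S, α.degree = n) → ∀ x,
      ∑ α ∈ S, chaosLevel u₀ n α t x ^ 2
        ≤ (√(n.factorial : ℝ) * (R * l ^ (-(9 / 16) : ℝ)) ^ n * M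
          * (t ^ (-(3 / 4) : ℝ) * Real.exp (l * t))) ^ 2 := by
  obtain ⟨C, hC0, hC⟩ := exists_integral_kernel_sq_le 0 zero_le_one hT
  -- Here `3/8` is the kernel exponent and `3/4` the singularity of the previous level. The gain
  -- `9/16` must exceed `1/2` to beat `√n!`, and `3/8 + 9/16 = 15/16` leaves a power `1/16` of time,
  -- absorbed by `T`.
  obtain ⟨K, hK0, hK⟩ := exists_integral_rpow_mul_exp_le (a := 3 / 8) (κ := 9 / 16) (b := 3 / 4)
    (by norm_num) (by norm_num) (by norm_num) (by norm_num) (by norm_num)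
  obtain ⟨M, hM⟩ := (isTame_chaosLevel_zero hu 0).bound T hT
  have hM0 : 0 ≤ M := by
    have := (abs_nonneg _).trans (hM T hT le_rfl 0)
    exact nonneg_of_mul_nonneg_left this (Real.rpow_pos_of_pos hT _)
  refine ⟨C * K * T ^ (1 / 16 : ℝ), M, by positivity, hM0, fun n => ?_⟩
  induction n with
  | zero =>
    intro l hl t ht htT S hS x
    have hsub : S ⊆ {0} := fun α hα =>
      Finset.mem_singleton.2 ((Finsupp.degree_eq_zero_iff α).1 (hS α hα))
    refine (Finset.sum_le_sum_of_subset_of_nonneg hsub fun _ _ _ => sq_nonneg _).trans ?_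
    rw [Finset.sum_singleton, ← sq_abs]
    refine pow_le_pow_left₀ (abs_nonneg _) ((hM t ht htT x).trans ?_) 2
    have h1 : 1 ≤ Real.exp (l * t) := Real.one_le_exp (by positivity)
    simp only [Nat.factorial_zero, Nat.cast_one, Real.sqrt_one, pow_zero, one_mul]
    exact mul_le_mul_of_nonneg_left (le_mul_of_one_le_right (by positivity) h1) hM0
  | succ n ih =>
    intro l hl t ht htT S hS x
    have hl0 : 0 < l := by linarith
    set B : ℝ := √(n.factorial : ℝ) * (C * K * T ^ (1 / 16 : ℝ) * l ^ (-(9 / 16) : ℝ)) ^ n * M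
      with hB
    have hB0 : 0 ≤ B := by positivity
    obtain ⟨hi, hle⟩ := hK t l ht hl0
    have he : (-(((0 : ℕ) : ℝ) / 2 + 3 / 8) : ℝ) = -(3 / 8) := by norm_num
    have hsum : ∀ α, Summable fun k : ℕ =>
        (1 + k : ℝ) * |duhamelCoeff (chaosSource (chaosLevel u₀ n) α) k t| := fun α =>
      (isTame_chaosSource hu n α).summable_duhamelCoeff ht
    have hfun : ∀ s, (t - s) ^ (-(3 / 8) : ℝ) * (B * (s ^ (-(3 / 4) : ℝ) * Real.exp (l * s)))
        = B * ((t - s) ^ (-(3 / 8) : ℝ) * (s ^ (-(3 / 4) : ℝ) * Real.exp (l * s))) := fun s => by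
      ring
    have hmain := sum_sq_duhamel_chaosSource_le hu n 0 hC0 hC ht htT
      (fun s => B * (s ^ (-(3 / 4) : ℝ) * Real.exp (l * s)))
      (fun s hs => by
        have h1 : 0 < s := hs.1
        positivity)
      (fun s hs S' hS' y => ih l hl s hs.1 (hs.2.le.trans htT) S' hS' y)
      (by
        simp only [he, hfun]
        exact hi.const_mul B) S hS (fun k => cosBasis k x)
      (fun k => by simpa using abs_cosBasis_le_one k x)
      (fun α _ => (summable_mul_cosBasis (hsum α) x).congr fun k => mul_comm _ _)
    simp only [he, hfun, integral_const_mul, mul_comm (cosBasis _ x)] at hmain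
    refine hmain.trans (pow_le_pow_left₀ ?_ ?_ 2)
    · have : 0 ≤ ∫ s in Ioo 0 t, (t - s) ^ (-(3 / 8) : ℝ)
          * (s ^ (-(3 / 4) : ℝ) * Real.exp (l * s)) :=
        setIntegral_nonneg measurableSet_Ioo fun s hs => by
          have h1 : 0 < s := hs.1
          have h2 : 0 < t - s := by linarith [hs.2]
          positivity
      positivity
    · have e2 : t ^ (1 - 3 / 8 - 9 / 16 - 3 / 4 : ℝ) = t ^ (1 / 16 : ℝ) * t ^ (-(3 / 4) : ℝ) := by
        rw [← Real.rpow_add ht]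
        norm_num
      have h3 : t ^ (1 / 16 : ℝ) ≤ T ^ (1 / 16 : ℝ) := Real.rpow_le_rpow ht.le htT (by norm_num)
      rw [e2] at hle
      have h4 : K * l ^ (-(9 / 16) : ℝ) * Real.exp (l * t) * (t ^ (1 / 16 : ℝ) * t ^ (-(3 / 4) : ℝ))
          ≤ K * l ^ (-(9 / 16) : ℝ) * Real.exp (l * t)
            * (T ^ (1 / 16 : ℝ) * t ^ (-(3 / 4) : ℝ)) := by gcongr
      refine (mul_le_mul_of_nonneg_left (mul_le_mul_of_nonneg_left (hle.trans h4) hB0)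
        (by positivity)).trans (le_of_eq ?_)
      rw [hB, ← sqrt_succ_mul_sqrt_factorial, pow_succ]
      ring

theorem hasDerivAt_chaosLevel_succ (hu : IntegrableOn u₀ (Ioo 0 Real.pi)) (n : ℕ) (α : MultiIdx)
    {t : ℝ} (ht : 0 < t) (x : ℝ) :
    HasDerivAt (chaosLevel u₀ (n + 1) α t)
      (∑' k, duhamelCoeff (chaosSource (chaosLevel u₀ n) α) k t * cosBasisDeriv k x) x :=
  hasDerivAt_cosSeries ((isTame_chaosSource hu n α).summable_duhamelCoeff ht) x

/-- Mean square bound for the derivative of the chaos of order `n + 1`. -/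
theorem exists_sum_sq_deriv_chaosLevel_le (hu : IntegrableOn u₀ (Ioo 0 Real.pi)) {t : ℝ}
    (ht : 0 < t) :
    ∃ R M : ℝ, 0 ≤ R ∧ 0 ≤ M ∧ ∀ (n : ℕ) (l : ℝ), 1 ≤ l →
      ∀ S : Finset MultiIdx, (∀ α ∈ S, α.degree = n + 1) → ∀ x,
      ∑ α ∈ S, deriv (chaosLevel u₀ (n + 1) α t) x ^ 2
        ≤ (√((n + 1).factorial : ℝ) * (R * l ^ (-(9 / 16) : ℝ)) ^ n * M * Real.exp (l * t)) ^ 2 := by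
  obtain ⟨R, M, hR0, hM0, hRM⟩ := exists_sum_sq_chaosLevel_le hu ht
  obtain ⟨C, hC0, hC⟩ := exists_integral_kernel_sq_le 1 le_rfl ht
  -- The derivative kernel enters once, in the last step, so no gain in `l` is needed there and
  -- integrability of `r ^ (-7/8)` suffices.
  obtain ⟨K, hK0, hK⟩ := exists_integral_rpow_mul_exp_le (a := 7 / 8) (κ := 0) (b := 3 / 4)
    (by norm_num) le_rfl (by norm_num) (by norm_num) (by norm_num)
  refine ⟨R, C * M * K * t ^ (1 - 7 / 8 - 0 - 3 / 4 : ℝ), hR0, by positivity,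
    fun n l hl S hS x => ?_⟩
  have hl0 : 0 < l := by linarith
  set B : ℝ := √(n.factorial : ℝ) * (R * l ^ (-(9 / 16) : ℝ)) ^ n * M with hB
  have hB0 : 0 ≤ B := by positivity
  obtain ⟨hi, hle⟩ := hK t l ht hl0
  have he : (-(((1 : ℕ) : ℝ) / 2 + 3 / 8) : ℝ) = -(7 / 8) := by norm_num
  have hsum : ∀ α, Summable fun k : ℕ =>
      (1 + k : ℝ) * |duhamelCoeff (chaosSource (chaosLevel u₀ n) α) k t| := fun α =>
    (isTame_chaosSource hu n α).summable_duhamelCoeff ht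
  have hfun : ∀ s, (t - s) ^ (-(7 / 8) : ℝ) * (B * (s ^ (-(3 / 4) : ℝ) * Real.exp (l * s)))
      = B * ((t - s) ^ (-(7 / 8) : ℝ) * (s ^ (-(3 / 4) : ℝ) * Real.exp (l * s))) := fun s => by
    ring
  have hmain := sum_sq_duhamel_chaosSource_le hu n 1 hC0 hC ht le_rfl
    (fun s => B * (s ^ (-(3 / 4) : ℝ) * Real.exp (l * s)))
    (fun s hs => by
      have h1 : 0 < s := hs.1
      positivity)
    (fun s hs S' hS' y => hRM n l hl s hs.1 hs.2.le S' hS' y)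
    (by
      simp only [he, hfun]
      exact hi.const_mul B) S hS (fun k => cosBasisDeriv k x)
    (fun k => by
      rw [pow_one]
      linarith [abs_cosBasisDeriv_le k x])
    (fun α _ => (summable_mul_cosBasisDeriv (hsum α) x).congr fun k => mul_comm _ _)
  simp only [he, hfun, integral_const_mul, mul_comm (cosBasisDeriv _ x)] at hmain
  simp only [(hasDerivAt_chaosLevel_succ hu n _ ht x).deriv]
  refine hmain.trans (pow_le_pow_left₀ ?_ ?_ 2)
  · have : 0 ≤ ∫ s in Ioo 0 t, (t - s) ^ (-(7 / 8) : ℝ)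
        * (s ^ (-(3 / 4) : ℝ) * Real.exp (l * s)) :=
      setIntegral_nonneg measurableSet_Ioo fun s hs => by
        have h1 : 0 < s := hs.1
        have h2 : 0 < t - s := by linarith [hs.2]
        positivity
    positivity
  · rw [neg_zero, Real.rpow_zero, mul_one] at hle
    refine (mul_le_mul_of_nonneg_left (mul_le_mul_of_nonneg_left hle hB0)
      (by positivity)).trans (le_of_eq ?_)
    rw [hB, ← sqrt_succ_mul_sqrt_factorial]
    ring

end Bounds

/-! ### Summability against every geometric weight -/

/-- With `l = n + 1`, the squared gain `(n+1) ^ (-9n/8)` against `(n+1)! ≤ (n+1) (n+1) ^ n` leaves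
`(n+1) ^ (-n/8)`, which beats every geometric factor, including `q ^ n` and `exp (2 n t)`. -/
theorem summable_factorial_decay (q R M t : ℝ) (hq : 0 ≤ q) :
    Summable fun n : ℕ => q ^ (n + 1) * (√((n + 1).factorial : ℝ)
      * (R * ((n : ℝ) + 1) ^ (-(9 / 16) : ℝ)) ^ n * M * Real.exp (((n : ℝ) + 1) * t)) ^ 2 := by
  set ρ : ℝ := q * R ^ 2 * Real.exp (2 * t) with hρ
  have hρ0 : 0 ≤ ρ := by positivity
  have hlim : Tendsto (fun n : ℕ => ρ * ((n : ℝ) + 1) ^ (-(1 / 8) : ℝ)) atTop (𝓝 0) := by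
    have h := (tendsto_rpow_neg_atTop (y := 1 / 8) (by norm_num)).comp
      (tendsto_atTop_add_const_right atTop (1 : ℝ) tendsto_natCast_atTop_atTop)
    simpa using h.const_mul ρ
  refine Summable.of_norm_bounded_eventually_nat
    (g := fun n => q * M ^ 2 * Real.exp (2 * t) * (1 / 2) ^ n)
    ((summable_geometric_two).mul_left _) ?_
  -- The threshold `1/4` leaves `(1/2) ^ n` after the stray factor `n + 1` is bounded by `2 ^ n`.
  filter_upwards [hlim.eventually_le_const (show (0 : ℝ) < 1 / 4 by norm_num)] with n hn
  have hn1 : (0 : ℝ) < (n : ℝ) + 1 := by positivity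
  rw [Real.norm_eq_abs, abs_of_nonneg (by positivity)]
  have hfac : ((n + 1).factorial : ℝ) ≤ ((n : ℝ) + 1) * ((n : ℝ) + 1) ^ n := by
    rw [← pow_succ']
    exact_mod_cast Nat.factorial_le_pow (n + 1)
  have hy : ((n : ℝ) + 1) * (((n : ℝ) + 1) ^ (-(9 / 16) : ℝ)) ^ 2
      = ((n : ℝ) + 1) ^ (-(1 / 8) : ℝ) := by
    nth_rewrite 1 [← Real.rpow_one ((n : ℝ) + 1)]
    rw [← Real.rpow_mul_natCast hn1.le, ← Real.rpow_add hn1]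
    norm_num
  have hexp : Real.exp (((n : ℝ) + 1) * t) ^ 2 = Real.exp (2 * t) * Real.exp (2 * t) ^ n := by
    rw [← pow_succ', ← Real.exp_nat_mul, ← Real.exp_nat_mul]
    push_cast
    ring_nf
  have h2n : (n : ℝ) + 1 ≤ 2 ^ n := by exact_mod_cast Nat.lt_two_pow_self
  calc q ^ (n + 1) * (√((n + 1).factorial : ℝ) * (R * ((n : ℝ) + 1) ^ (-(9 / 16) : ℝ)) ^ n * M
        * Real.exp (((n : ℝ) + 1) * t)) ^ 2
      = q ^ (n + 1) * (((n + 1).factorial : ℝ) * ((R * ((n : ℝ) + 1) ^ (-(9 / 16) : ℝ)) ^ 2) ^ n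
        * M ^ 2 * (Real.exp (2 * t) * Real.exp (2 * t) ^ n)) := by
        rw [mul_pow, mul_pow, mul_pow, Real.sq_sqrt (by positivity), hexp, ← pow_mul, ← pow_mul,
          mul_comm n 2]
    _ ≤ q ^ (n + 1) * ((((n : ℝ) + 1) * ((n : ℝ) + 1) ^ n)
        * ((R * ((n : ℝ) + 1) ^ (-(9 / 16) : ℝ)) ^ 2) ^ n
        * M ^ 2 * (Real.exp (2 * t) * Real.exp (2 * t) ^ n)) := by gcongr
    _ = q * M ^ 2 * Real.exp (2 * t) * (((n : ℝ) + 1)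
        * (ρ * (((n : ℝ) + 1) * (((n : ℝ) + 1) ^ (-(9 / 16) : ℝ)) ^ 2)) ^ n) := by
        simp only [hρ, mul_pow, pow_succ]
        ring
    _ ≤ q * M ^ 2 * Real.exp (2 * t) * (2 ^ n * (1 / 4) ^ n) := by
        rw [hy]
        gcongr
    _ = _ := by
        rw [← mul_pow]
        norm_num

/-- Summability over multi-indices from bounds over the multi-indices of each degree. -/
theorem MultiIdx.summable_of_sum_degree_le (d : MultiIdx → ℝ) {q : ℝ} (hq : 0 ≤ q) (B : ℕ → ℝ)
    (hB : ∀ n, ∀ S : Finset MultiIdx, (∀ α ∈ S, α.degree = n) → ∑ α ∈ S, d α ^ 2 ≤ B n)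
    (hsum : Summable fun n => q ^ n * B n) :
    Summable fun α : MultiIdx => q ^ α.degree * d α ^ 2 := by
  have hB0 : ∀ n, 0 ≤ B n := fun n => by simpa using hB n ∅ (by simp)
  refine summable_of_sum_le (c := ∑' n, q ^ n * B n) (fun α => by positivity) fun S => ?_
  rw [← Finset.sum_fiberwise_of_maps_to (t := S.image fun α => α.degree)
    (g := fun α => α.degree) fun α hα => Finset.mem_image_of_mem _ hα]
  refine le_trans (Finset.sum_le_sum fun n _ => ?_)
    (hsum.sum_le_tsum (S.image fun α => α.degree) fun n _ => mul_nonneg (pow_nonneg hq n) (hB0 n))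
  calc ∑ α ∈ S with α.degree = n, q ^ α.degree * d α ^ 2
      = q ^ n * ∑ α ∈ S with α.degree = n, d α ^ 2 := by
        rw [Finset.mul_sum]
        exact Finset.sum_congr rfl fun α hα => by rw [(Finset.mem_filter.1 hα).2]
    _ ≤ _ := mul_le_mul_of_nonneg_left (hB n _ fun α hα => (Finset.mem_filter.1 hα).2)
        (pow_nonneg hq n)

theorem summable_deriv_chaosSolution {u₀ : ℝ → ℝ} (hu : IntegrableOn u₀ (Ioo 0 Real.pi)) {t : ℝ}
    (ht : 0 < t) (x : ℝ) {q : ℝ} (hq : 0 ≤ q) :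
    Summable fun α : MultiIdx => q ^ α.degree * deriv (chaosSolution u₀ α t) x ^ 2 := by
  obtain ⟨R, M, -, -, hRM⟩ := exists_sum_sq_deriv_chaosLevel_le hu ht
  set B : ℕ → ℝ := fun n => match n with
    | 0 => deriv (chaosSolution u₀ 0 t) x ^ 2
    | n + 1 => (√((n + 1).factorial : ℝ)
      * (R * ((n : ℝ) + 1) ^ (-(9 / 16) : ℝ)) ^ n * M * Real.exp (((n : ℝ) + 1) * t)) ^ 2 with hB
  refine MultiIdx.summable_of_sum_degree_le _ hq B (fun n S hS => ?_) ?_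
  · cases n with
    | zero =>
      have hsub : S ⊆ {0} := fun α hα =>
        Finset.mem_singleton.2 ((Finsupp.degree_eq_zero_iff α).1 (hS α hα))
      refine (Finset.sum_le_sum_of_subset_of_nonneg hsub fun _ _ _ => sq_nonneg _).trans ?_
      rw [Finset.sum_singleton]
    | succ n =>
      -- The weight `l` may depend on the degree because `R` and `M` do not depend on `l`; it is
      -- taken to be `n + 1`.
      refine (Finset.sum_le_sum fun α hα => le_of_eq ?_).trans
        (hRM n ((n : ℝ) + 1) (by simp) S hS x)
      rw [chaosSolution, hS α hα]
  · rw [← summable_nat_add_iff 1]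
    exact summable_factorial_decay q R M t hq

/-! ### Cosine expansions of test functions and the weak form -/

theorem continuous_cosSeries_of_summable {b : ℕ → ℝ} (hb : Summable fun k => |b k|) :
    Continuous (cosSeries b) :=
  continuous_tsum (fun k => continuous_const.mul (continuous_cosBasis k)) hb fun k x => by
    rw [norm_mul, Real.norm_eq_abs, Real.norm_eq_abs]
    exact mul_le_of_le_one_right (abs_nonneg _) (abs_cosBasis_le_one k x)

/-- Testing an integrable function against an absolutely convergent cosine series. -/
theorem hasSum_mul_cosCoeff {b : ℕ → ℝ} (hb : Summable fun k => |b k|) {f ψ : ℝ → ℝ}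
    (hψ : ∀ x ∈ Icc 0 Real.pi, ψ x = cosSeries b x) (hf : IntegrableOn f (Ioo 0 Real.pi)) :
    HasSum (fun k => b k * cosCoeff f k) (∫ x in Ioo 0 Real.pi, f x * ψ x) := by
  have hi : ∀ k, IntegrableOn (fun x => b k * (f x * cosBasis k x)) (Ioo 0 Real.pi) := fun k =>
    (integrableOn_mul_cosBasis hf k).const_mul _
  have h := hasSum_integral_of_summable_integral_norm hi ?_
  · simp only [integral_const_mul] at h
    have e : ∫ x in Ioo 0 Real.pi, ∑' k, b k * (f x * cosBasis k x)
        = ∫ x in Ioo 0 Real.pi, f x * ψ x := by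
      refine setIntegral_congr_fun measurableSet_Ioo fun x hx => ?_
      simp only [hψ x (Ioo_subset_Icc_self hx), cosSeries, mul_left_comm (b _), tsum_mul_left]
    rwa [e] at h
  · refine (hb.mul_right (∫ x in Ioo 0 Real.pi, |f x|)).of_nonneg_of_le
      (fun k => integral_nonneg fun x => norm_nonneg _) fun k => ?_
    rw [← integral_const_mul]
    refine integral_mono (hi k).norm (hf.abs.const_mul _) fun x => ?_
    simp only [norm_mul, Real.norm_eq_abs]
    exact mul_le_mul_of_nonneg_left
      (mul_le_of_le_one_right (abs_nonneg _) (abs_cosBasis_le_one k x)) (abs_nonneg _)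

theorem cosCoeff_cosSeries {b : ℕ → ℝ} (hb : Summable fun k => |b k|) (k : ℕ) :
    cosCoeff (cosSeries b) k = b k := by
  have h := hasSum_mul_cosCoeff hb (f := cosBasis k) (ψ := cosSeries b) (fun _ _ => rfl)
    ((continuous_cosBasis k).integrableOn_Icc.mono_set Ioo_subset_Icc_self)
  simp only [cosCoeff, integral_cosBasis_mul_cosBasis] at h
  have h2 := h.unique (hasSum_single k fun j hj => by simp [hj.symm])
  rw [if_pos rfl, mul_one] at h2
  rw [← h2, cosCoeff]
  congr 1
  ext x
  ring

/-- Testing a source in space and time against an absolutely convergent cosine series. -/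
theorem IsTame.hasSum_mul_integral_cosCoeff {F : ℝ → ℝ → ℝ} (hF : IsTame F) {b : ℕ → ℝ}
    (hb : Summable fun k => |b k|) {ψ : ℝ → ℝ} (hψ : ∀ x ∈ Icc 0 Real.pi, ψ x = cosSeries b x)
    {t : ℝ} (ht : 0 < t) :
    HasSum (fun k => b k * ∫ s in Ioo 0 t, cosCoeff (F s) k)
      (∫ s in Ioo 0 t, ∫ x in Ioo 0 Real.pi, F s x * ψ x) := by
  obtain ⟨C, hC⟩ := hF.bound t ht
  have hi : ∀ k, IntegrableOn (fun s => b k * cosCoeff (F s) k) (Ioo 0 t) := fun k =>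
    (hF.integrableOn_cosCoeff k ht).const_mul _
  have hCi : IntegrableOn (fun s => C * s ^ (-(3 / 4) : ℝ) * Real.pi) (Ioo 0 t) :=
    ((integrableOn_rpow_Ioo (by norm_num) ht).const_mul C).mul_const _
  have h := hasSum_integral_of_summable_integral_norm hi ?_
  · simp only [integral_const_mul] at h
    have e : ∫ s in Ioo 0 t, ∑' k, b k * cosCoeff (F s) k
        = ∫ s in Ioo 0 t, ∫ x in Ioo 0 Real.pi, F s x * ψ x :=
      setIntegral_congr_fun measurableSet_Ioo fun s hs =>
        (hasSum_mul_cosCoeff hb hψ (hF.integrableOn hs.1)).tsum_eq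
    rwa [e] at h
  · refine (hb.mul_right (∫ s in Ioo 0 t, C * s ^ (-(3 / 4) : ℝ) * Real.pi)).of_nonneg_of_le
      (fun k => integral_nonneg fun x => norm_nonneg _) fun k => ?_
    rw [← integral_const_mul]
    refine setIntegral_mono_on (hi k).norm (hCi.const_mul _) measurableSet_Ioo fun s hs => ?_
    rw [norm_mul, Real.norm_eq_abs, Real.norm_eq_abs]
    exact mul_le_mul_of_nonneg_left (abs_cosCoeff_le (fun x => hC s hs.1 hs.2.le x) k)
      (abs_nonneg _)

theorem hasDerivAt_cosBasisDeriv (k : ℕ) (x : ℝ) :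
    HasDerivAt (cosBasisDeriv k) (-((k : ℝ) ^ 2 * cosBasis k x)) x := by
  have h := ((((hasDerivAt_id x).const_mul (k : ℝ)).sin.const_mul (cosBasis k 0)).const_mul
    (k : ℝ)).neg
  refine h.congr_deriv ?_
  rw [cosBasis_eq k x]
  simp
  ring

/-- The cosine coefficients of a second derivative. -/
theorem cosCoeff_deriv_deriv {φ : ℝ → ℝ} (hφ : ContDiff ℝ ((⊤ : ℕ∞) : WithTop ℕ∞) φ) (k : ℕ) :
    cosCoeff (deriv (deriv φ)) k
      = deriv φ Real.pi * cosBasis k Real.pi - deriv φ 0 * cosBasis k 0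
        - (k : ℝ) ^ 2 * cosCoeff φ k := by
  have hφ1 : ContDiff ℝ ((⊤ : ℕ∞) : WithTop ℕ∞) (deriv φ) := hφ.iterate_deriv 1
  have hφ2 : ContDiff ℝ ((⊤ : ℕ∞) : WithTop ℕ∞) (deriv (deriv φ)) := hφ.iterate_deriv 2
  have hne : ((⊤ : ℕ∞) : WithTop ℕ∞) ≠ 0 := by simp
  have hd0 : ∀ x, HasDerivAt φ (deriv φ x) x := fun x => (hφ.differentiable hne x).hasDerivAt
  have hd1 : ∀ x, HasDerivAt (deriv φ) (deriv (deriv φ) x) x := fun x =>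
    (hφ1.differentiable hne x).hasDerivAt
  have hcd : Continuous (cosBasisDeriv k) := by unfold cosBasisDeriv; fun_prop
  have i1 := intervalIntegral.integral_mul_deriv_eq_deriv_mul (a := 0) (b := Real.pi)
    (fun x _ => hasDerivAt_cosBasis k x) (fun x _ => hd1 x) (hcd.intervalIntegrable _ _)
    (hφ2.continuous.intervalIntegrable _ _)
  have i2 := intervalIntegral.integral_mul_deriv_eq_deriv_mul (a := 0) (b := Real.pi)
    (fun x _ => hasDerivAt_cosBasisDeriv k x) (fun x _ => hd0 x)
    ((continuous_const.mul (continuous_cosBasis k)).neg.intervalIntegrable _ _)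
    (hφ1.continuous.intervalIntegrable _ _)
  -- In the second integration by parts the boundary terms vanish with the sines; only those
  -- carrying `deriv φ` survive.
  have z0 : cosBasisDeriv k 0 = 0 := by simp [cosBasisDeriv]
  have z1 : cosBasisDeriv k Real.pi = 0 := by simp [cosBasisDeriv, Real.sin_nat_mul_pi]
  rw [z0, z1] at i2
  have e3 : ∫ x in (0 : ℝ)..Real.pi, -((k : ℝ) ^ 2 * cosBasis k x) * φ x
      = -((k : ℝ) ^ 2 * ∫ x in (0 : ℝ)..Real.pi, φ x * cosBasis k x) := by
    rw [← intervalIntegral.integral_const_mul, ← intervalIntegral.integral_neg]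
    congr 1
    ext x
    ring
  rw [cosCoeff, cosCoeff, setIntegral_Ioo_eq_intervalIntegral Real.pi_pos.le,
    setIntegral_Ioo_eq_intervalIntegral Real.pi_pos.le]
  simp only [mul_comm (deriv (deriv φ) _)]
  rw [i1, i2, e3]
  ring

theorem integrableOn_of_continuous {f : ℝ → ℝ} (hf : Continuous f) (a b : ℝ) :
    IntegrableOn f (Ioo a b) :=
  hf.integrableOn_Icc.mono_set Ioo_subset_Icc_self

/-- Two integrations by parts give decay `D / k²`. The boundary terms are kept in `D`, so the result
also covers `φ''`, which need not satisfy the Neumann conditions. -/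
theorem summable_abs_cosCoeff {φ : ℝ → ℝ} (hφ : ContDiff ℝ ((⊤ : ℕ∞) : WithTop ℕ∞) φ) :
    Summable fun k => |cosCoeff φ k| := by
  have hφ2 : ContDiff ℝ ((⊤ : ℕ∞) : WithTop ℕ∞) (deriv (deriv φ)) := hφ.iterate_deriv 2
  set D := |deriv φ Real.pi| + |deriv φ 0| + ∫ x in Ioo 0 Real.pi, |deriv (deriv φ) x| with hD
  refine Summable.of_norm_bounded_eventually_nat (g := fun k : ℕ => D * (1 / (k : ℝ) ^ 2))
    ((Real.summable_one_div_nat_pow.2 one_lt_two).mul_left D) ?_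
  filter_upwards [eventually_gt_atTop 0] with k hk
  have hk' : (0 : ℝ) < k := by exact_mod_cast hk
  rw [Real.norm_eq_abs, abs_abs, mul_one_div, le_div_iff₀ (by positivity)]
  have h := cosCoeff_deriv_deriv hφ k
  have h1 := abs_cosCoeff_le_integral (integrableOn_of_continuous hφ2.continuous 0 Real.pi) k
  have h2 : |deriv φ Real.pi * cosBasis k Real.pi| ≤ |deriv φ Real.pi| := by
    rw [abs_mul]
    exact mul_le_of_le_one_right (abs_nonneg _) (abs_cosBasis_le_one k _)
  have h3 : |deriv φ 0 * cosBasis k 0| ≤ |deriv φ 0| := by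
    rw [abs_mul]
    exact mul_le_of_le_one_right (abs_nonneg _) (abs_cosBasis_le_one k _)
  have h4 : |cosCoeff φ k| * (k : ℝ) ^ 2 = |deriv φ Real.pi * cosBasis k Real.pi
      - deriv φ 0 * cosBasis k 0 - cosCoeff (deriv (deriv φ)) k| := by
    rw [h, ← abs_of_pos (show (0 : ℝ) < (k : ℝ) ^ 2 by positivity), ← abs_mul,
      abs_of_pos (show (0 : ℝ) < (k : ℝ) ^ 2 by positivity)]
    congr 1
    ring
  rw [h4, hD]
  exact (abs_sub _ _).trans (add_le_add ((abs_sub _ _).trans (add_le_add h2 h3)) h1)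

/-- A smooth function on `[0, π]` is the sum of its cosine series. -/
theorem eq_cosSeries {φ : ℝ → ℝ} (hφ : ContDiff ℝ ((⊤ : ℕ∞) : WithTop ℕ∞) φ) :
    ∀ x ∈ Icc 0 Real.pi, φ x = cosSeries (cosCoeff φ) x := by
  have hs := summable_abs_cosCoeff hφ
  have hc := continuous_cosSeries_of_summable hs
  intro x hx
  refine sub_eq_zero.1 (eq_zero_of_integral_mul_cosBasis_eq_zero
    (g := fun x => φ x - cosSeries (cosCoeff φ) x) (hφ.continuous.sub hc).continuousOn
    (fun k => ?_) x hx)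
  simp only [sub_mul]
  rw [integral_sub (integrableOn_mul_cosBasis (integrableOn_of_continuous hφ.continuous _ _) k)
    (integrableOn_mul_cosBasis (integrableOn_of_continuous hc _ _) k), sub_eq_zero]
  exact (cosCoeff_cosSeries hs k).symm

/-- The integral form of the equation satisfied by a convolution with an exponential. -/
theorem integral_exp_mul_eq {l : ℝ} (hl : 0 ≤ l) {f : ℝ → ℝ} (hfm : Measurable f) {t : ℝ}
    (hf : IntegrableOn f (Ioo 0 t)) :
    ∫ s in Ioo 0 t, Real.exp (-(l * (t - s))) * f s
      = -l * (∫ r in Ioo 0 t, ∫ s in Ioo 0 r, Real.exp (-(l * (r - s))) * f s)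
        + ∫ s in Ioo 0 t, f s := by
  -- Fubini on the triangle `s < r < t`: integrating `l exp (-l (r - s))` over `r` gives `1 - exp
  -- (-l (t - s))`, and integrating over `s` first gives the double integral.
  set g : ℝ → ℝ → ℝ := fun r s =>
    {z : ℝ × ℝ | z.2 < z.1}.indicator (fun z => l * Real.exp (-(l * (z.1 - z.2))) * f z.2) (r, s)
    with hg
  have hgm : Measurable (Function.uncurry g) :=
    Measurable.indicator ((by fun_prop : Measurable fun z : ℝ × ℝ =>
      l * Real.exp (-(l * (z.1 - z.2)))).mul (hfm.comp measurable_snd))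
      (measurableSet_lt measurable_snd measurable_fst)
  have hgi : Integrable (Function.uncurry g)
      ((volume.restrict (Ioo 0 t)).prod (volume.restrict (Ioo 0 t))) := by
    refine Integrable.mono' ((integrable_const (l : ℝ)).mul_prod hf.abs)
      hgm.aestronglyMeasurable (ae_of_all _ fun z => ?_)
    obtain ⟨r, s⟩ := z
    simp only [Function.uncurry, hg, indicator, mem_ofPred_eq]
    split_ifs with h
    · rw [norm_mul, norm_mul, Real.norm_eq_abs, Real.norm_eq_abs, Real.norm_eq_abs, abs_of_nonneg hl,
        Real.abs_exp]
      refine mul_le_mul_of_nonneg_right (mul_le_of_le_one_right hl (Real.exp_le_one_iff.2 ?_))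
        (abs_nonneg _)
      have := mul_nonneg hl (sub_nonneg.2 h.le)
      linarith
    · rw [norm_zero]
      positivity
  have hswap := integral_integral_swap hgi
  have e1 : ∀ r ∈ Ioo 0 t, ∫ s in Ioo 0 t, g r s
      = l * ∫ s in Ioo 0 r, Real.exp (-(l * (r - s))) * f s := by
    intro r hr
    have e : ∀ s, g r s = (Iio r).indicator (fun s => l * (Real.exp (-(l * (r - s))) * f s)) s :=
      fun s => by
        simp only [hg, indicator, mem_ofPred_eq, mem_Iio]
        split_ifs <;> ring
    simp only [e]
    rw [setIntegral_indicator measurableSet_Iio, ← integral_const_mul]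
    congr 2
    ext s
    simp only [mem_inter_iff, mem_Ioo, mem_Iio]
    constructor
    · rintro ⟨⟨h1, -⟩, h2⟩
      exact ⟨h1, h2⟩
    · rintro ⟨h1, h2⟩
      exact ⟨⟨h1, h2.trans hr.2⟩, h2⟩
  have e2 : ∀ s ∈ Ioo 0 t, ∫ r in Ioo 0 t, g r s = f s - Real.exp (-(l * (t - s))) * f s := by
    intro s hs
    have e : ∀ r, g r s = (Ioi s).indicator (fun r => (l * Real.exp (-(l * (r - s)))) * f s) r :=
      fun r => by
        simp only [hg, indicator, mem_ofPred_eq, mem_Ioi]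
    simp only [e]
    have hset : Ioo 0 t ∩ Ioi s = Ioo s t := by
      ext r
      simp only [mem_inter_iff, mem_Ioo, mem_Ioi]
      constructor
      · rintro ⟨⟨-, h1⟩, h2⟩
        exact ⟨h2, h1⟩
      · rintro ⟨h1, h2⟩
        exact ⟨⟨hs.1.trans h1, h2⟩, h1⟩
    have hder : ∀ r, HasDerivAt (fun r => -Real.exp (-(l * (r - s))))
        (l * Real.exp (-(l * (r - s)))) r := fun r => by
      refine (((((hasDerivAt_id r).sub_const s).const_mul l).neg).exp.neg).congr_deriv ?_
      simp
      ring
    rw [setIntegral_indicator measurableSet_Ioi, hset, integral_mul_const,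
      setIntegral_Ioo_eq_intervalIntegral hs.2.le,
      intervalIntegral.integral_eq_sub_of_hasDerivAt (fun r _ => hder r)
        (Continuous.intervalIntegrable (by fun_prop) _ _)]
    simp
    ring
  rw [setIntegral_congr_fun measurableSet_Ioo e1, setIntegral_congr_fun measurableSet_Ioo e2,
    integral_const_mul, integral_sub hf] at hswap
  · linarith
  · refine Integrable.bdd_mul (c := 1) hf (by fun_prop) ?_
    filter_upwards [ae_restrict_mem measurableSet_Ioo] with s hs
    rw [Real.norm_eq_abs, Real.abs_exp, Real.exp_le_one_iff]
    have := mul_nonneg hl (sub_nonneg.2 hs.2.le)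
    linarith

theorem IsTame.duhamelCoeff_eq {F : ℝ → ℝ → ℝ} (hF : IsTame F) (k : ℕ) {t : ℝ} (ht : 0 < t) :
    duhamelCoeff F k t = -(k : ℝ) ^ 2 * (∫ s in Ioo 0 t, duhamelCoeff F k s)
      + ∫ s in Ioo 0 t, cosCoeff (F s) k :=
  integral_exp_mul_eq (sq_nonneg (k : ℝ)) (hF.measurable_cosCoeff k)
    (hF.integrableOn_cosCoeff k ht)

/-- A function satisfying the integrated equation `d' = -l d`, `d(0) = 0` vanishes. -/
theorem eq_zero_of_eq_neg_mul_integral {l : ℝ} {d : ℝ → ℝ}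
    (hd : ∀ t > 0, IntegrableOn d (Ioo 0 t)) (h : ∀ t > 0, d t = -l * ∫ s in Ioo 0 t, d s) :
    ∀ t > 0, d t = 0 := by
  intro t ht
  set D : ℝ → ℝ := fun r => ∫ s in (0 : ℝ)..r, d s with hD
  have hii : ∀ r, 0 ≤ r → IntervalIntegrable d volume 0 r := fun r hr => by
    rcases hr.eq_or_lt with rfl | hr
    · simp
    · exact (intervalIntegrable_iff_integrableOn_Ioo_of_le hr.le).2 (hd r hr)
  have hdD : ∀ r > 0, d r = -l * D r := fun r hr => by
    rw [h r hr, setIntegral_Ioo_eq_intervalIntegral hr.le]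
  have hDc : ∀ T > 0, ContinuousOn D (Icc 0 T) := fun T hT => by
    have := intervalIntegral.continuousOn_primitive_interval (μ := volume) (f := d) (a := 0) (b := T)
      (by
        rw [uIcc_of_le hT.le, integrableOn_Icc_iff_integrableOn_Ioo]
        exact hd T hT)
    rwa [uIcc_of_le hT.le] at this
  -- Bootstrap: an integrable `d` has a continuous primitive, the equation makes `d` continuous, and
  -- the primitive is then differentiable.
  have hdc : ContinuousOn d (Ioi 0) := by
    intro r hr
    have hr : 0 < r := hr
    have h1 : ContinuousAt D r :=
      (hDc (r + 1) (by linarith)).continuousAt (Icc_mem_nhds hr (by linarith))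
    have h2 : ContinuousAt (fun r => -l * D r) r := h1.const_mul (-l)
    refine (h2.congr ?_).continuousWithinAt
    filter_upwards [Ioi_mem_nhds hr] with s hs using (hdD s hs).symm
  have hDd : ∀ r > 0, HasDerivAt D (d r) r := fun r hr =>
    intervalIntegral.integral_hasDerivAt_right (hii r hr.le)
      (hdc.stronglyMeasurableAtFilter isOpen_Ioi r hr) (hdc.continuousAt (Ioi_mem_nhds hr))
  -- The function `exp (l r) D r` has zero derivative on `(0, t)` and vanishes at `0`; the mean
  -- value theorem needs only continuity at the endpoints.
  obtain ⟨c, hc, hslope⟩ := exists_hasDerivAt_eq_slope (fun r => Real.exp (l * r) * D r)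
    (fun _ => 0) ht ((Continuous.continuousOn (by fun_prop)).mul (hDc t ht)) fun r hr => by
      refine ((((hasDerivAt_id r).const_mul l).exp).mul (hDd r hr.1)).congr_deriv ?_
      simp only [id]
      rw [hdD r hr.1]
      ring
  have hD0 : D 0 = 0 := by simp [hD]
  rw [eq_comm, div_eq_zero_iff, or_iff_left (by linarith), hD0] at hslope
  have : D t = 0 := by
    simpa using hslope
  rw [hdD t ht, this, mul_zero]

theorem IsNeumannTest.cosCoeff_deriv_deriv {φ : ℝ → ℝ} (hφ : IsNeumannTest φ) (k : ℕ) :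
    cosCoeff (deriv (deriv φ)) k = -(k : ℝ) ^ 2 * cosCoeff φ k := by
  rw [_root_.cosCoeff_deriv_deriv hφ.smooth, hφ.deriv_zero, hφ.deriv_pi]
  ring

theorem summable_abs_of_summable_mul {a : ℕ → ℝ} (ha : Summable fun k : ℕ => (1 + k : ℝ) * |a k|) :
    Summable fun k => |a k| :=
  ha.of_nonneg_of_le (fun k => abs_nonneg _) fun k => by
    have : (0 : ℝ) ≤ k := Nat.cast_nonneg k
    nlinarith [abs_nonneg (a k)]

/-- A cosine series whose coefficients solve the integrated heat equation with source `F` is a weak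
solution. -/
theorem weak_of_coeff {v F : ℝ → ℝ → ℝ} (hv : IsTame v) (hF : IsTame F) {a : ℕ → ℝ → ℝ} {f : ℝ → ℝ}
    (hf : IntegrableOn f (Ioo 0 Real.pi))
    (hva : ∀ t > 0, v t = cosSeries fun k => a k t)
    (ha : ∀ t > 0, Summable fun k : ℕ => (1 + k : ℝ) * |a k t|)
    (heq : ∀ k, ∀ t > 0, a k t = cosCoeff f k - (k : ℝ) ^ 2 * (∫ s in Ioo 0 t, a k s)
      + ∫ s in Ioo 0 t, cosCoeff (F s) k)
    {φ : ℝ → ℝ} (hφ : IsNeumannTest φ) {t : ℝ} (ht : 0 < t) :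
    ∫ x in Ioo 0 Real.pi, v t x * φ x = (∫ x in Ioo 0 Real.pi, f x * φ x)
      + (∫ s in Ioo 0 t, ∫ x in Ioo 0 Real.pi, v s x * deriv (deriv φ) x)
      + ∫ s in Ioo 0 t, ∫ x in Ioo 0 Real.pi, F s x * φ x := by
  have hφ2 : ContDiff ℝ ((⊤ : ℕ∞) : WithTop ℕ∞) (deriv (deriv φ)) := hφ.smooth.iterate_deriv 2
  have hs := summable_abs_cosCoeff hφ.smooth
  have hcoef : ∀ s > 0, ∀ k, cosCoeff (v s) k = a k s := fun s hs k => by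
    rw [hva s hs, cosCoeff_cosSeries (summable_abs_of_summable_mul (ha s hs))]
  have h0 := hasSum_mul_cosCoeff hs (eq_cosSeries hφ.smooth) (hv.integrableOn ht)
  have h1 := hasSum_mul_cosCoeff hs (eq_cosSeries hφ.smooth) hf
  -- `φ''` is expanded in its own cosine series, whose coefficients are `-k²` times those of `φ` by
  -- the Neumann conditions. The weak identity thus reduces termwise to `heq`.
  have h2 := hv.hasSum_mul_integral_cosCoeff (summable_abs_cosCoeff hφ2) (eq_cosSeries hφ2) ht
  have h3 := hF.hasSum_mul_integral_cosCoeff hs (eq_cosSeries hφ.smooth) ht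
  refine h0.unique ?_
  convert (h1.add h2).add h3 using 1
  ext k
  rw [hcoef t ht, heq k t ht, hφ.cosCoeff_deriv_deriv,
    setIntegral_congr_fun measurableSet_Ioo fun s hs => hcoef s hs.1 k]
  ring

theorem exp_eq_sub_mul_integral (l c t : ℝ) (ht : 0 < t) :
    Real.exp (-(l * t)) * c = c - l * ∫ s in Ioo 0 t, Real.exp (-(l * s)) * c := by
  have hder : ∀ r, HasDerivAt (fun r => -Real.exp (-(l * r))) (l * Real.exp (-(l * r))) r :=
    fun r => by
      refine (((hasDerivAt_id r).const_mul l).neg.exp.neg).congr_deriv ?_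
      simp
      ring
  rw [integral_mul_const, ← mul_assoc, ← integral_const_mul,
    setIntegral_Ioo_eq_intervalIntegral ht.le,
    intervalIntegral.integral_eq_sub_of_hasDerivAt (fun r _ => hder r)
      (Continuous.intervalIntegrable (by fun_prop) _ _)]
  simp
  ring

/-! ### Existence and uniqueness of the chaos solution -/

section Solution

variable {u₀ : ℝ → ℝ}

theorem chaosSource_chaosSolution {n : ℕ} {α : MultiIdx} (hα : α.degree = n + 1) (s x : ℝ) :
    chaosSource (chaosSolution u₀) α s x = chaosSource (chaosLevel u₀ n) α s x :=
  Finset.sum_congr rfl fun k hk => by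
    rw [chaosSolution, MultiIdx.degree_sub_single hα hk]

theorem isChaosSolution_chaosSolution (hu : IntegrableOn u₀ (Ioo 0 Real.pi)) :
    IsChaosSolution u₀ (chaosSolution u₀) where
  continuousOn α t ht := by
    unfold chaosSolution
    generalize α.degree = n
    cases n with
    | zero =>
      simp only [chaosLevel, if_pos ht]
      exact (continuous_cosSeries (summable_exp_mul_cosCoeff hu ht)).continuousOn
    | succ n =>
      exact (continuous_cosSeries
        ((isTame_chaosSource hu n α).summable_duhamelCoeff ht)).continuousOn
  integrable α T hT := (isTame_chaosLevel hu α.degree α).integrableOn_prod hT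
  propagator α φ hφ t ht := by
    rcases hn : α.degree with _ | n
    · obtain rfl := (Finsupp.degree_eq_zero_iff α).1 hn
      have h := weak_of_coeff (isTame_chaosLevel_zero hu 0) IsTame.zero
        (a := fun k t => Real.exp (-((k : ℝ) ^ 2 * t)) * cosCoeff u₀ k) hu
        (fun t ht => by
          ext x
          simp only [chaosLevel, if_pos ht])
        (fun t ht => summable_exp_mul_cosCoeff hu ht)
        (fun k t ht => by
          rw [exp_eq_sub_mul_integral _ _ t ht]
          simp [cosCoeff]) hφ ht
      simpa [chaosSolution] using h
    · have h0 : α ≠ 0 := by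
        rintro rfl
        simp at hn
      -- In positive degree the initial datum is zero and all the forcing comes from the previous
      -- level.
      have h := weak_of_coeff (f := fun _ => 0) (isTame_chaosLevel hu (n + 1) α)
        (isTame_chaosSource hu n α)
        (a := fun k t => duhamelCoeff (chaosSource (chaosLevel u₀ n) α) k t) (integrable_zero _ _ _)
        (fun t _ => rfl)
        (fun t ht => (isTame_chaosSource hu n α).summable_duhamelCoeff ht)
        (fun k t ht => by
          rw [(isTame_chaosSource hu n α).duhamelCoeff_eq k ht]
          simp [cosCoeff]) hφ ht
      simp only [← chaosSource_chaosSolution hn] at h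
      simpa only [chaosSolution, hn, h0, if_false, zero_mul, integral_zero, chaosSource] using h

/-- The cosines are admissible test functions and Neumann eigenfunctions, so testing against them
decouples the propagator into scalar equations. -/
theorem isNeumannTest_cosBasis (k : ℕ) : IsNeumannTest (cosBasis k) ∧
    deriv (deriv (cosBasis k)) = fun x => -(k : ℝ) ^ 2 * cosBasis k x := by
  have h1 : deriv (cosBasis k) = cosBasisDeriv k := funext fun x => (hasDerivAt_cosBasis k x).deriv
  refine ⟨⟨?_, ?_, ?_⟩, ?_⟩
  · rw [funext (cosBasis_eq k)]
    fun_prop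
  · simp [h1, cosBasisDeriv]
  · simp [h1, cosBasisDeriv, Real.sin_nat_mul_pi]
  · rw [h1]
    ext x
    rw [(hasDerivAt_cosBasisDeriv k x).deriv]
    ring

namespace IsChaosSolution

variable {u u' : MultiIdx → ℝ → ℝ → ℝ}

/-- Fubini turns joint integrability of the solution into integrability in time of each coefficient.
-/
theorem integrableOn_cosCoeff (h : IsChaosSolution u₀ u) (α : MultiIdx) (k : ℕ) {t : ℝ}
    (ht : 0 < t) : IntegrableOn (fun s => cosCoeff (u α s) k) (Ioo 0 t) := by
  have h1 := h.integrable α t ht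
  have h2 : IntegrableOn (fun z : ℝ × ℝ => u α z.1 z.2 * cosBasis k z.2)
      (Ioo 0 t ×ˢ Ioo 0 Real.pi) :=
    Integrable.mul_bdd (c := 1) h1
      ((continuous_cosBasis k).comp continuous_snd).aestronglyMeasurable
      (Eventually.of_forall fun z => abs_cosBasis_le_one k z.2)
  rw [IntegrableOn, Measure.volume_eq_prod, ← Measure.prod_restrict] at h2
  exact h2.integral_prod_left

/-- The chaos solution is unique. -/
theorem unique (h : IsChaosSolution u₀ u) (h' : IsChaosSolution u₀ u') (n : ℕ) (α : MultiIdx)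
    (hα : α.degree = n) : ∀ t > 0, ∀ x ∈ Icc 0 Real.pi, u' α t x = u α t x := by
  induction n using Nat.strong_induction_on generalizing α with
  | _ n ih =>
  -- By induction on the degree both solutions have the same source, so it cancels in the
  -- difference.
  have hlow : ∀ k ∈ α.support, ∀ t > 0, ∀ x ∈ Icc 0 Real.pi,
      u' (α - Finsupp.single k 1) t x = u (α - Finsupp.single k 1) t x := by
    intro k hk
    have hpos : n ≠ 0 := by
      rintro rfl
      rw [(Finsupp.degree_eq_zero_iff α).1 hα] at hk
      simp at hk
    obtain ⟨m, rfl⟩ := Nat.exists_eq_succ_of_ne_zero hpos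
    exact ih m (Nat.lt_succ_self m) _ (MultiIdx.degree_sub_single hα hk)
  have hzero : ∀ k, ∀ t > 0, cosCoeff (u' α t) k - cosCoeff (u α t) k = 0 := by
    intro k
    obtain ⟨hk, hkd⟩ := isNeumannTest_cosBasis k
    refine eq_zero_of_eq_neg_mul_integral (l := (k : ℝ) ^ 2) (fun t ht =>
      (h'.integrableOn_cosCoeff α k ht).sub (h.integrableOn_cosCoeff α k ht)) fun t ht => ?_
    have p := h.propagator α _ hk t ht
    have p' := h'.propagator α _ hk t ht
    have hsrc : ∫ s in Ioo 0 t, ∫ x in Ioo 0 Real.pi, (∑ j ∈ α.support, √(α j : ℝ) * cosBasis j x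
          * u' (α - Finsupp.single j 1) s x) * cosBasis k x
        = ∫ s in Ioo 0 t, ∫ x in Ioo 0 Real.pi, (∑ j ∈ α.support, √(α j : ℝ) * cosBasis j x
          * u (α - Finsupp.single j 1) s x) * cosBasis k x := by
      refine setIntegral_congr_fun measurableSet_Ioo fun s hs => ?_
      refine setIntegral_congr_fun measurableSet_Ioo fun x hx => ?_
      congr 1
      exact Finset.sum_congr rfl fun j hj => by rw [hlow j hj s hs.1 x (Ioo_subset_Icc_self hx)]
    have hd : ∀ w : ℝ → ℝ → ℝ, ∫ s in Ioo 0 t, ∫ x in Ioo 0 Real.pi, w s x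
        * deriv (deriv (cosBasis k)) x = -(k : ℝ) ^ 2 * ∫ s in Ioo 0 t, cosCoeff (w s) k := by
      intro w
      simp only [hkd, mul_left_comm (w _ _), integral_const_mul, cosCoeff]
    rw [hd] at p p'
    rw [integral_sub (h'.integrableOn_cosCoeff α k ht) (h.integrableOn_cosCoeff α k ht)]
    rw [hsrc] at p'
    unfold cosCoeff at p p' ⊢
    rw [p, p']
    ring
  intro t ht
  have hc := h.continuousOn α t ht
  have hc' := h'.continuousOn α t ht
  intro x hx
  refine sub_eq_zero.1 (eq_zero_of_integral_mul_cosBasis_eq_zero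
    (g := fun x => u' α t x - u α t x) (hc'.sub hc) (fun k => ?_) x hx)
  have hi : ∀ w : ℝ → ℝ, ContinuousOn w (Icc 0 Real.pi) → IntegrableOn w (Ioo 0 Real.pi) :=
    fun w hw => hw.integrableOn_Icc.mono_set Ioo_subset_Icc_self
  simp only [sub_mul]
  rw [integral_sub (integrableOn_mul_cosBasis (hi _ hc') k) (integrableOn_mul_cosBasis (hi _ hc) k)]
  exact hzero k t ht

end IsChaosSolution

theorem differentiable_chaosSolution (hu : IntegrableOn u₀ (Ioo 0 Real.pi)) (α : MultiIdx) {t : ℝ}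
    (ht : 0 < t) : Differentiable ℝ (chaosSolution u₀ α t) := by
  unfold chaosSolution
  generalize α.degree = n
  intro x
  cases n with
  | zero =>
    simp only [chaosLevel, if_pos ht]
    exact (hasDerivAt_cosSeries (summable_exp_mul_cosCoeff hu ht) x).differentiableAt
  | succ n => exact (hasDerivAt_chaosLevel_succ hu n α ht x).differentiableAt

end Solution

/-! ### Conclusion -/

theorem mainTheorem10 {Ω : Type*} [MeasurableSpace Ω] (P : Measure Ω) [IsProbabilityMeasure P]
    (W : L2Interval → Ω → ℝ) (hW : IsWhiteNoise P W)
    (p : ℝ≥0∞) (hp : 1 ≤ p) (u₀ : ℝ → ℝ) (hu₀ : MemLp u₀ p intervalMeasure) :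
    ∃ u : MultiIdx → ℝ → ℝ → ℝ, IsChaosSolution u₀ u ∧
      (∀ u' : MultiIdx → ℝ → ℝ → ℝ, IsChaosSolution u₀ u' →
        ∀ α, ∀ t > 0, ∀ x ∈ Icc 0 Real.pi, u' α t x = u α t x) ∧
      ∀ t > 0, ∀ x ∈ Ioo 0 Real.pi,
        (∀ α, DifferentiableAt ℝ (u α t) x) ∧
        ∃ v : Ω → ℝ, IsChaosSum P W (fun α => deriv (u α t) x) v ∧
          (∀ α, chaosCoeff P W v α = deriv (u α t) x) ∧
          ∀ q : ℝ, 1 < q → MemL2q P W q v := by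
  -- On a bounded interval `L_p` embeds in `L_1`, and integrability is all that the estimates use.
  have hu : IntegrableOn u₀ (Ioo 0 Real.pi) := hu₀.integrable hp
  have hsol := isChaosSolution_chaosSolution hu
  refine ⟨chaosSolution u₀, hsol, fun u' hu' α => hsol.unique hu' α.degree α rfl,
    fun t ht x _ => ⟨fun α => differentiable_chaosSolution hu α ht x, ?_⟩⟩
  exact hW.exists_isChaosSum _ fun q hq =>
    summable_deriv_chaosSolution hu ht x (zero_le_one.trans hq.le)
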